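/- **Notation.** Let $n\ge 5$, $L\ge 2$ be integers, $\varepsilon\ge 0$ a rational number, $\mathbf E\subseteq\mathbb N$, and $A_n$ an alphabet of $n$ letters. The period $\mathrm{per}(v)$ of a nonempty word $v$ is the least $p\ge1$ with $v(i)=v(i+p)$ whenever both positions exist. A word over $A_n$ is a *threshold word* if $|v|/\mathrm{per}(v)\le\frac n{n-1}$ for each of its nonempty factors $v$; a right-infinite word is a threshold word if all its finite factors are. Put $\chi(k)=0$ for $k\in\mathbf E$ and $\chi(k)=1$ otherwise. For $x\neq\lambda$ ($\lambda$ is the empty word) the word $xyx$ is called *$(|x|,e)$-exponential* if $\frac{|xyx|+e}{|xy|}\le\frac n{n-1}$. An *$(\varepsilon,\mathbf E)$-threshold word* is a threshold word in which every factor $xyx$ with $x\ne\lambda$, $|x|\notin\mathbf E$ is $(|x|,\varepsilon)$-exponential. **Systems of images.** For every letter $a$ let $\mathbf V_a\subseteq A_n^L$ be a nonempty set of words of length $L$ (images of $a$), $\mathbb V=\bigcup_a\mathbf V_a$, and for all $a\ne b$ and $v\in\mathbf V_a$ let $\delta_b(v)\subseteq\mathbf V_b$. Write $\Delta_n=\{\delta_a\}$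 and $\delta_-=\min\{|\delta_b(v)|: v\in\mathbf V_a,\ a\neq b\}$. Let $\mathsf{lcp}(u,v)$, $\mathsf{lcs}(u,v)$ be the lengths of the longest common prefix and suffix of $u,v$, and let $\mathsf{lcp}$, $\mathsf{lcs}$ be the maxima of these numbers over images $u,v$ of two different letters. A *substitution* $\phi$ on an $(\varepsilon,\mathbf E)$-threshold word $w$ is a choice of images $\phi_j(w)\in\mathbf V_{w[j]}$ ($1\le j\le|w|$) such that (M1) $\phi_j(w)\in\delta_{w[j]}(\phi_{j-1}(w))$ for $j>1$; (M2) if $xyx=w[i+1..i+r]$, $x\ne\lambda$, $|x|\in\mathbf E$, is not $(|x|,\varepsilon)$-exponential, then $\phi_m(w)\ne\phi_{m+|xy|}(w)$ for some $i<m\le i+|x|$. Its result is $\phi(w)=\phi_1(w)\cdots\phi_{|w|}(w)$. For words $x',y'$, let $\Delta(x',y')\in\mathbb N_0\cup\{\infty\}$ be the least $k\ge0$ such that for some $(\varepsilon,\mathbf E)$-threshold word $w$ and some substitution $\phi$ on it $|\phi(w)|=kL+|x'|+|y'|$, $x'$ is a prefix and $y'$ a suffix of $\phi(w)$ ($\infty$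 if there is none). **Consistency.** Below, a star $*$ stands for arbitrary, possibly different, possibly empty words. The gaps ($z,z_1,z_2$, and also $y,z$ in 2.1.2) may be empty; the pieces of the repeated word ($x$ in 2.1.0 and 2.1.2; $x,y$ in 2.1.1, 2.1.3, 2.2 and 2.3; $x,y,z$ in 3.2) are nonempty. An inequality containing $\Delta=\infty$ counts as true. $\Delta_n$ is *$(L,\varepsilon,\mathbf E)$-consistent* if for all $u_1\in\mathbf V_a$, $v_1\in\delta_b(u_1)$, $w_1\in\delta_e(v_1)$ with $a,b,e$ pairwise different, all $u_2\in\mathbf V_c$, $v_2\in\delta_d(u_2)$ with $c\ne d$, and all $u,v,w\in\mathbb V$: - (1.1) $\mathrm{per}(u)=L$. (1.2) No nonempty suffix of an image of a letter is a prefix of an image of a different letter. - (2.1.0) Every factor $xyx$ of $u$ is $(|x|,\varepsilon\chi(|x|))$-exponential. - (2.1.1) If $u_1=*xyzx$, $v_1=y*$, then $xyzxy$ is $(|xy|,\varepsilon\chi(|xy|))$-exponential. - (2.1.2) If $u=*xy$, $v=zx*$, $|x|<L$, then $\frac{\Delta(u,v)L+|xyzx|+\varepsilon\chi(|x|)}{\Delta(u,v)L+|xyz|}\le\frac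 n{n-1}$. - (2.1.3) If $u_1=*x$, $v_1=yzxy*$, then $xyzxy$ is $(|xy|,\varepsilon\chi(|xy|))$-exponential. - (2.2.1) If $u=*x$, $v=yz_1$, $w=z_2xy*$, where the letter of $v$ differs from those of $u$ and $w$, then $\frac{DL+|xyz_1z_2xy|+\varepsilon\chi(|xy|)}{DL+|xyz_1z_2|}\le\frac n{n-1}$ with $D=\Delta(uv,w)$. - (2.2.2) If $u_1=*x$, $v_1=yzx$, $w_1=y*$, then $xyzxy$ is $(|xy|,\varepsilon\chi(|xy|))$-exponential. - (2.2.3) If $u=*xyz_1$, $v=z_2x$, $w=y*$, where the letter of $v$ differs from those of $u$ and $w$, then the inequality of (2.2.1) holds with $D=\Delta(u,vw)$. - (2.3) If $u_1=*x$, $v_1=yz_1$, $u_2=z_2x$, $v_2=y*$, $a\neq c$, $b\neq d$, then the inequality of (2.2.1) holds with $D=\Delta(u_1v_1,u_2v_2)$. - (3.1) If $u_1\ne u_2$, then $\mathsf{lcp}(u_1,u_2)\le L-\mathsf{lcs}-\varepsilon$ and $\mathsf{lcs}(u_1,u_2)\le L-\mathsf{lcp}-\varepsilon$. - (3.2) If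 $u_1=*x$, $v_1=yz*$, $u_2=*xy$, $v_2=z*$, then $\frac{L(n-2)+|y|+|xyz|+\varepsilon\chi(|xyz|)}{L(n-2)+|y|}\le\frac n{n-1}$. **Statement.** Assume that $\Delta_n$ is $(L,\varepsilon,\mathbf E)$-consistent, $\varepsilon(L-1)=\mathsf{lcs}+\mathsf{lcp}$ and $\delta_->|\mathbf E|$. Then: (1) there is an infinite threshold word over $n$ letters; (2) if moreover $\varepsilon\le\frac1{n-1}$, the number of threshold words over $n$ letters grows exponentially: there are $C>0$ and $\gamma>1$ such that for every $m\ge0$ there are at least $C\gamma^m$ threshold words of length $m$ over $n$ letters. -/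

import Mathlib

/-!
Words over the alphabet `Fin n` are lists. A word `x ++ y ++ x` is a repetition with root `x ++ y`
and repeated part `x`.
-/

namespace ThresholdWords

/-- The period of a word: the least `p ≥ 1` with `w(i) = w(i + p)` whenever both
positions exist.
(For a nonempty word this is at most its length.) -/
noncomputable def period {n : ℕ} (w : List (Fin n)) : ℕ :=
  sInf {p : ℕ | 0 < p ∧ w.HasPeriod p}

/-- Threshold words over `n ≥ 5` letters: every nonempty factor has exponent at most `n/(n-1)`. -/
def IsThreshold {n : ℕ} (w : List (Fin n)) : Prop :=
  ∀ v : List (Fin n), v ≠ [] → v <:+: w →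
    (v.length : ℚ) / (period v : ℚ) ≤ (n : ℚ) / ((n : ℚ) - 1)

/-- A right-infinite threshold word: all finite factors are threshold words. -/
def IsInfiniteThreshold {n : ℕ} (f : ℕ → Fin n) : Prop :=
  ∀ i k : ℕ, IsThreshold ((List.range k).map fun j => f (i + j))

/-- The number of threshold words of length `m` over `n` letters. -/
noncomputable def thresholdCount (n m : ℕ) : ℕ :=
  Set.ncard {w : List (Fin n) | w.length = m ∧ IsThreshold w}

/-- A repetition whose root has length `g` and whose repeated part has length `r` satisfies
`(g + r + e) / g ≤ n/(n-1)`. -/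
def ExpBound (n g r : ℕ) (e : ℚ) : Prop :=
  ((g : ℚ) + (r : ℚ) + e) / (g : ℚ) ≤ (n : ℚ) / ((n : ℚ) - 1)

/-- `x ++ y ++ x` is `(|x|, e)`-exponential. -/
def IsExponential {n : ℕ} (x y : List (Fin n)) (e : ℚ) : Prop :=
  ExpBound n (x ++ y).length x.length e

/-- The characteristic function of the complement of `E`. -/
noncomputable def chi (E : Set ℕ) (k : ℕ) : ℚ := Set.indicator Eᶜ (fun _ => (1 : ℚ)) k

/-- `(ε, E)`-threshold words. -/
def IsEpsThreshold {n : ℕ} (ε : ℚ) (E : Set ℕ) (w : List (Fin n)) : Prop :=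
  IsThreshold w ∧ ∀ x y : List (Fin n), x ≠ [] → x ++ y ++ x <:+: w →
    x.length ∉ E → IsExponential x y ε

/-- Length of the longest common prefix. -/
noncomputable def lcp {n : ℕ} (u v : List (Fin n)) : ℕ :=
  sSup {k : ℕ | ∃ x : List (Fin n), x <+: u ∧ x <+: v ∧ x.length = k}

/-- Length of the longest common suffix. -/
noncomputable def lcs {n : ℕ} (u v : List (Fin n)) : ℕ :=
  sSup {k : ℕ | ∃ x : List (Fin n), x <:+ u ∧ x <:+ v ∧ x.length = k}

/-- For every letter `a` a nonempty set `V a` of words of length `L` (the possible images of `a`),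
together with the functions `δ b`, which send an image `v` of a letter `a ≠ b` to the set of images
of `b` that are allowed to follow `v` immediately. -/
structure ImageSystem (n L : ℕ) where
  V : Fin n → Finset (List (Fin n))
  V_nonempty : ∀ a, (V a).Nonempty
  V_length : ∀ a, ∀ u ∈ V a, u.length = L
  δ : Fin n → List (Fin n) → Finset (List (Fin n))
  δ_subset : ∀ a b, a ≠ b → ∀ v ∈ V a, δ b v ⊆ V b

namespace ImageSystem

variable {n L : ℕ} (S : ImageSystem n L)

/-- `δ₋`, the least number of images of a letter `b` allowed after an image of a letter `a ≠ b`. -/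
noncomputable def deltaMin : ℕ :=
  sInf {k : ℕ | ∃ a b, a ≠ b ∧ ∃ v ∈ S.V a, k = (S.δ b v).card}

/-- The longest common prefix of images of two different letters. -/
noncomputable def lcpV : ℕ :=
  sSup {k : ℕ | ∃ a b, a ≠ b ∧ ∃ u ∈ S.V a, ∃ v ∈ S.V b, k = lcp u v}

/-- The longest common suffix of images of two different letters. -/
noncomputable def lcsV : ℕ :=
  sSup {k : ℕ | ∃ a b, a ≠ b ∧ ∃ u ∈ S.V a, ∃ v ∈ S.V b, k = lcs u v}

/-- `ψ` is the list of the letter images `φ₁(w), φ₂(w), …` of an `(L, ε, E, Δ)`-substitution `φ`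
applied to `w`; the word `φ(w)` itself is `ψ.flatten`. -/
structure IsSubstitution (ε : ℚ) (E : Set ℕ) (w : List (Fin n)) (ψ : List (List (Fin n))) :
    Prop where
  length_eq : ψ.length = w.length
  mem_V : ∀ (i : ℕ) (a : Fin n) (u : List (Fin n)),
    w[i]? = some a → ψ[i]? = some u → u ∈ S.V a
  /-- each image is allowed after the preceding one -/
  follows : ∀ (j : ℕ) (a : Fin n) (u v : List (Fin n)),
    w[j + 1]? = some a → ψ[j]? = some u → ψ[j + 1]? = some v → v ∈ S.δ a u
  /-- the two occurrences of the repeated part of a critical repetition get different images -/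
  splits : ∀ l x y r : List (Fin n), w = l ++ (x ++ y ++ x) ++ r → x ≠ [] → x.length ∈ E →
    ¬ IsExponential x y ε →
    ∃ m < x.length, ψ[l.length + m]? ≠ ψ[l.length + m + (x ++ y).length]?

/-- The distance `Δ(x', y')`: the least `k` such that, for some `(ε, E)`-threshold word `w` and some
substitution, the image of `w` has prefix `x'` and suffix `y'`, with the images of exactly `k`
letters of `w` between them; `⊤` if there is no such `k`. -/
noncomputable def gap (ε : ℚ) (E : Set ℕ) (x' y' : List (Fin n)) : ℕ∞ :=
  ⨅ k ∈ {k : ℕ | ∃ (w : List (Fin n)) (ψ : List (List (Fin n))),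
      IsEpsThreshold ε E w ∧ S.IsSubstitution ε E w ψ ∧
      L * w.length = L * k + x'.length + y'.length ∧
      x' <+: ψ.flatten ∧ y' <:+ ψ.flatten}, (k : ℕ∞)

/-- The bound `(d L + g + r + ε χ(r)) / (d L + g) ≤ n/(n-1)`; no condition if `d = ⊤`. -/
def GapBound (n L : ℕ) (ε : ℚ) (E : Set ℕ) (d : ℕ∞) (g r : ℕ) : Prop :=
  ∀ k : ℕ, d = (k : ℕ∞) → ExpBound n (k * L + g) r (ε * chi E r)

/-- `(L, ε, E)`-consistent systems. The words `α`, `β`, … are arbitrary, possibly empty, remainders;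
so are the pieces of a root that lie between the two occurrences of the repeated part. The pieces
into which the repeated part is cut by the boundaries of the images are nonempty. -/
structure Consistent (ε : ℚ) (E : Set ℕ) : Prop where
  uf11 : ∀ a, ∀ u ∈ S.V a, period u = L
  uf12 : ∀ a b, a ≠ b → ∀ u ∈ S.V a, ∀ v ∈ S.V b, ∀ x : List (Fin n), x ≠ [] →
    x <:+ u → ¬ x <+: v
  /-- repetitions inside one image -/
  uf210 : ∀ a, ∀ u ∈ S.V a, ∀ x y : List (Fin n), x ≠ [] → x ++ y ++ x <:+: u →
    IsExponential x y (ε * chi E x.length)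
  uf211 : ∀ a b, a ≠ b → ∀ u₁ ∈ S.V a, ∀ v₁ ∈ S.δ b u₁, ∀ α β x y z : List (Fin n),
    x ≠ [] → y ≠ [] → u₁ = α ++ x ++ y ++ z ++ x → v₁ = y ++ β →
    IsExponential (x ++ y) z (ε * chi E (x ++ y).length)
  /-- `a = b` is allowed; the repeated part is a proper factor of the images -/
  uf212 : ∀ a b, ∀ u ∈ S.V a, ∀ v ∈ S.V b, ∀ α β x y z : List (Fin n),
    x ≠ [] → x.length < L → u = α ++ x ++ y → v = z ++ x ++ β →
    GapBound n L ε E (S.gap ε E u v) (x ++ y ++ z).length x.length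
  uf213 : ∀ a b, a ≠ b → ∀ u₁ ∈ S.V a, ∀ v₁ ∈ S.δ b u₁, ∀ α β x y z : List (Fin n),
    x ≠ [] → y ≠ [] → u₁ = α ++ x → v₁ = y ++ z ++ x ++ y ++ β →
    IsExponential (x ++ y) z (ε * chi E (x ++ y).length)
  /-- the first and the third image may belong to the same letter -/
  uf221 : ∀ a b c, a ≠ b → b ≠ c → ∀ u ∈ S.V a, ∀ v ∈ S.V b, ∀ w ∈ S.V c,
    ∀ α β x y z₁ z₂ : List (Fin n), x ≠ [] → y ≠ [] →
    u = α ++ x → v = y ++ z₁ → w = z₂ ++ x ++ y ++ β →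
    GapBound n L ε E (S.gap ε E (u ++ v) w) (x ++ y ++ z₁ ++ z₂).length (x ++ y).length
  uf222 : ∀ a b e, a ≠ b → b ≠ e → e ≠ a →
    ∀ u₁ ∈ S.V a, ∀ v₁ ∈ S.δ b u₁, ∀ w₁ ∈ S.δ e v₁, ∀ α β x y z : List (Fin n),
    x ≠ [] → y ≠ [] → u₁ = α ++ x → v₁ = y ++ z ++ x → w₁ = y ++ β →
    IsExponential (x ++ y) z (ε * chi E (x ++ y).length)
  /-- the first and the third image may belong to the same letter -/
  uf223 : ∀ a b c, a ≠ b → b ≠ c → ∀ u ∈ S.V a, ∀ v ∈ S.V b, ∀ w ∈ S.V c,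
    ∀ α β x y z₁ z₂ : List (Fin n), x ≠ [] → y ≠ [] →
    u = α ++ x ++ y ++ z₁ → v = z₂ ++ x → w = y ++ β →
    GapBound n L ε E (S.gap ε E u (v ++ w)) (x ++ y ++ z₁ ++ z₂).length (x ++ y).length
  /-- `u₁`, `u₂` are images of different letters, and so are `v₁`, `v₂` -/
  uf23 : ∀ a b c d, a ≠ b → c ≠ d → a ≠ c → b ≠ d →
    ∀ u₁ ∈ S.V a, ∀ v₁ ∈ S.δ b u₁, ∀ u₂ ∈ S.V c, ∀ v₂ ∈ S.δ d u₂,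
    ∀ α β x y z₁ z₂ : List (Fin n), x ≠ [] → y ≠ [] →
    u₁ = α ++ x → v₁ = y ++ z₁ → u₂ = z₂ ++ x → v₂ = y ++ β →
    GapBound n L ε E (S.gap ε E (u₁ ++ v₁) (u₂ ++ v₂))
      (x ++ y ++ z₁ ++ z₂).length (x ++ y).length
  uf31 : ∀ a c, ∀ u₁ ∈ S.V a, ∀ u₂ ∈ S.V c, u₁ ≠ u₂ →
    (lcp u₁ u₂ : ℚ) ≤ (L : ℚ) - S.lcsV - ε ∧ (lcs u₁ u₂ : ℚ) ≤ (L : ℚ) - S.lcpV - ε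
  /-- equal letters of a threshold word are separated by at least `n - 2` letters, so the root of
  the repetition below has length at least `L (n - 2) + |y|` -/
  uf32 : ∀ a b c d, a ≠ b → c ≠ d →
    ∀ u₁ ∈ S.V a, ∀ v₁ ∈ S.δ b u₁, ∀ u₂ ∈ S.V c, ∀ v₂ ∈ S.δ d u₂,
    ∀ α β α' β' x y z : List (Fin n), x ≠ [] → y ≠ [] → z ≠ [] →
    u₁ = α ++ x → v₁ = y ++ z ++ β → u₂ = α' ++ x ++ y → v₂ = z ++ β' →
    ExpBound n (L * (n - 2) + y.length) (x ++ y ++ z).length (ε * chi E (x ++ y ++ z).length)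

end ImageSystem

end ThresholdWords

/-!
The infinite threshold word is obtained by iterating: the image of an `(ε, E)`-threshold word under
a substitution is again an `(ε, E)`-threshold word, `L` times longer.

Consider a repetition in an image. If the length of its root is not a multiple of `L`, the two
occurrences of the repeated part are cut differently into images, and as no suffix of an image is a
prefix of an image of another letter, only the configurations (2.1.0)-(2.3), (3.2) are left, or the
repeated part is shorter than `L` and the root at least `(n - 1) * L` long. If the length of the
root is `k * L`, a repeated part that contains `m` images comes from a repetition with root `k` and
repeated part `m` or more in the preimage, except for overhangs of at most `lcsV` and `lcpV` letters
on the two sides. The equation `ε * (L - 1) = lcsV + lcpV` says precisely that the `ε` spared in the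
preimage pays for the overhangs and for the `ε` required in the image. A repetition in the preimage
that spares nothing has its repeated part of length in `E`; its parts get different images.

To choose a substitution from left to right one avoids, for each length in `E`, at most one image of
the current letter, so `|E| < δ₋` suffices. If `ε ≤ 1 / (n - 1)`, no repetition with repeated part
of length `1 ∈ E` constrains both of two consecutive letters, since its root is of length `n - 1`;
thus at least two images are available at one of them, and the number of substitutions is
exponential.
-/

namespace ThresholdWords

section Factor

variable {α : Type*} {f g : ℕ → α} {i j k p r : ℕ}

/-- The factor of length `r` at position `i` of the infinite word `f`. Finite words are studied as
prefixes of infinite ones, so that a position needs no proof that it is in range. -/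
def factor (f : ℕ → α) (i r : ℕ) : List α := (List.range r).map fun j => f (i + j)

/-- The word `f` has at position `i` a repetition with root of length `p` and repeated part of
length `r`. The two occurrences of the repeated part may overlap. -/
def RepeatsAt (f : ℕ → α) (i p r : ℕ) : Prop := ∀ t < r, f (i + t) = f (i + t + p)

@[simp] theorem length_factor (f : ℕ → α) (i r : ℕ) : (factor f i r).length = r := by
  simp [factor]

theorem getElem?_factor (f : ℕ → α) (i : ℕ) (h : j < r) :
    (factor f i r)[j]? = some (f (i + j)) := by
  simp [factor, h]

theorem getElem?_factor_eq_some_iff {a : α} :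
    (factor f i r)[j]? = some a ↔ j < r ∧ f (i + j) = a := by
  simp [factor, List.getElem?_eq_some_iff]

theorem factor_eq_factor_iff : factor f i r = factor g j r ↔ ∀ t < r, f (i + t) = g (j + t) := by
  simp [factor]

theorem factor_ne_nil (f : ℕ → α) (i : ℕ) (hr : 0 < r) : factor f i r ≠ [] :=
  List.ne_nil_of_length_pos (by simpa using hr)

theorem factor_add (f : ℕ → α) (i a b : ℕ) :
    factor f i (a + b) = factor f i a ++ factor f (i + a) b := by
  simp [factor, List.range_add, List.map_map, Function.comp_def, Nat.add_assoc]

theorem factor_eq_append (f : ℕ → α) {a b c : ℕ} (hj : j = i + a) (hc : c = a + b) :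
    factor f i c = factor f i a ++ factor f j b := by
  subst hj hc; exact factor_add f i a b

theorem factor_eq_append₃ (f : ℕ → α) {a b c d : ℕ} (hj : j = i + a) (hk : k = j + b)
    (hd : d = a + b + c) : factor f i d = factor f i a ++ factor f j b ++ factor f k c := by
  subst hj hk hd; simp only [factor_add, Nat.add_assoc, List.append_assoc]

theorem factor_eq_append₄ (f : ℕ → α) {l a b c d e : ℕ} (hj : j = i + a) (hk : k = j + b)
    (hl : l = k + c) (he : e = a + b + c + d) :
    factor f i e = factor f i a ++ factor f j b ++ factor f k c ++ factor f l d := by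
  subst hj hk hl he; simp only [factor_add, Nat.add_assoc, List.append_assoc]

theorem factor_eq_append₅ (f : ℕ → α) {l m a b c d e s : ℕ} (hj : j = i + a) (hk : k = j + b)
    (hl : l = k + c) (hm : m = l + d) (hs : s = a + b + c + d + e) :
    factor f i s =
      factor f i a ++ factor f j b ++ factor f k c ++ factor f l d ++ factor f m e := by
  subst hj hk hl hm hs; simp only [factor_add, Nat.add_assoc, List.append_assoc]

theorem factor_prefix (f : ℕ → α) (i : ℕ) {a c : ℕ} (h : a ≤ c) : factor f i a <+: factor f i c :=
  ⟨factor f (i + a) (c - a), (factor_eq_append f rfl (by lia)).symm⟩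

theorem factor_suffix (f : ℕ → α) {b c : ℕ} (h : i + c = j + b) (hb : b ≤ c) :
    factor f j b <:+ factor f i c :=
  ⟨factor f i (c - b), (factor_eq_append f (by lia) (by lia)).symm⟩

theorem factor_infix (f : ℕ → α) {b c : ℕ} (h : i ≤ j) (hb : j + b ≤ i + c) :
    factor f j b <:+: factor f i c :=
  ⟨factor f i (j - i), factor f (j + b) (i + c - (j + b)),
    (factor_eq_append₃ f (by lia) rfl (by lia)).symm⟩

theorem eq_factor_of_append_eq {s v t : List α} (h : s ++ v ++ t = factor f i r) :
    v = factor f (i + s.length) v.length ∧ s.length + v.length + t.length = r := by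
  have hr : s.length + v.length + t.length = r := by
    simpa [Nat.add_assoc] using congrArg List.length h
  rw [← hr, factor_add, factor_add] at h
  exact ⟨(List.append_inj (List.append_inj h (by simp)).1 (by simp)).2, hr⟩

theorem flatten_factor {ψ : ℕ → List α} {L : ℕ}
    (h : ∀ q, i ≤ q → q < i + k → ψ q = factor f (q * L) L) :
    (factor ψ i k).flatten = factor f (i * L) (k * L) := by
  induction k with
  | zero => simp [factor]
  | succ k ih =>
    rw [factor_add, List.flatten_append, ih fun q h₁ h₂ => h q h₁ (by lia), Nat.succ_mul,
      factor_add, ← Nat.add_mul]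
    congr 1
    simpa [factor] using h (i + k) (by lia) (by lia)

theorem RepeatsAt.mono {r' : ℕ} (h : RepeatsAt f i p r) (hr : r' ≤ r) : RepeatsAt f i p r' :=
  fun t ht => h t (by lia)

theorem RepeatsAt.extend_left (h : RepeatsAt f (i + 1) p r) (he : f i = f (i + p)) :
    RepeatsAt f i p (r + 1) := by
  rintro (_ | t) ht
  · exact he
  · have := h t (by lia)
    rwa [show i + 1 + t = i + (t + 1) by lia] at this

theorem RepeatsAt.extend_right (h : RepeatsAt f i p r) (he : f (i + r) = f (i + r + p)) :
    RepeatsAt f i p (r + 1) := by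
  intro t ht
  rcases Nat.lt_succ_iff_lt_or_eq.1 ht with ht | rfl
  exacts [h t ht, he]

theorem repeatsAt_iff_factor_eq : RepeatsAt f i p r ↔ factor f i r = factor f (i + p) r := by
  simp only [RepeatsAt, factor_eq_factor_iff, Nat.add_right_comm]

theorem RepeatsAt.factor_eq {a b c : ℕ} (h : RepeatsAt f i p r) (ha : i ≤ a) (hb : b = a + p)
    (hc : a + c ≤ i + r) : factor f b c = factor f a c := by
  subst hb
  refine (repeatsAt_iff_factor_eq.1 fun t ht => ?_).symm
  have := h (a - i + t) (by lia)
  rwa [show i + (a - i + t) = a + t by lia] at this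

theorem repeatsAt_of_append_eq_factor {s x y t : List α}
    (h : s ++ (x ++ y ++ x) ++ t = factor f i k) :
    RepeatsAt f (i + s.length) (x ++ y).length x.length ∧
      s.length + (x ++ y).length + x.length ≤ k := by
  obtain ⟨hleft, -⟩ :=
    eq_factor_of_append_eq (show s ++ x ++ (y ++ x ++ t) = factor f i k by simpa using h)
  obtain ⟨hright, hlen⟩ :=
    eq_factor_of_append_eq (show (s ++ (x ++ y)) ++ x ++ t = factor f i k by simpa using h)
  rw [List.length_append, ← Nat.add_assoc] at hright
  exact ⟨repeatsAt_iff_factor_eq.2 (hleft.symm.trans hright),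
    by rw [List.length_append] at hlen; lia⟩

/-- A repetition inside `f[0..M)` that cannot be extended to either side within `f[0..M)`. -/
structure IsMaximalRepetition (f : ℕ → α) (M i p r : ℕ) : Prop where
  le : i + p + r ≤ M
  repeatsAt : RepeatsAt f i p r
  left : 0 < i → f (i - 1) ≠ f (i - 1 + p)
  right : i + p + r < M → f (i + r) ≠ f (i + r + p)

theorem RepeatsAt.exists_isMaximalRepetition {M : ℕ} (h : RepeatsAt f i p r)
    (hM : i + p + r ≤ M) : ∃ i' r', r ≤ r' ∧ IsMaximalRepetition f M i' p r' := by
  induction hd : M - r using Nat.strong_induction_on generalizing i r with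
  | _ d ih =>
  by_cases hleft : 0 < i ∧ f (i - 1) = f (i - 1 + p)
  · obtain ⟨i, rfl⟩ : ∃ j, i = j + 1 := Nat.exists_eq_succ_of_ne_zero hleft.1.ne'
    obtain ⟨i', r', hr', hmax⟩ := ih (M - (r + 1)) (by lia) (h.extend_left hleft.2) (by lia) rfl
    exact ⟨i', r', by lia, hmax⟩
  by_cases hright : i + p + r < M ∧ f (i + r) = f (i + r + p)
  · obtain ⟨i', r', hr', hmax⟩ := ih (M - (r + 1)) (by lia) (h.extend_right hright.2) (by lia) rfl
    exact ⟨i', r', by lia, hmax⟩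
  exact ⟨i, r, le_rfl, hM, h, fun hi he => hleft ⟨hi, he⟩, fun hi he => hright ⟨hi, he⟩⟩

end Factor

section Period

variable {n : ℕ}

theorem period_pos_and_hasPeriod {v : List (Fin n)} (hv : v ≠ []) :
    0 < period v ∧ v.HasPeriod (period v) := by
  have hmem : period v ∈ {p : ℕ | 0 < p ∧ v.HasPeriod p} :=
    Nat.sInf_mem ⟨v.length, List.length_pos_iff.2 hv, v.hasPeriod_of_length_le _ le_rfl⟩
  exact hmem

theorem period_le {v : List (Fin n)} {p : ℕ} (hp : 0 < p) (h : v.HasPeriod p) : period v ≤ p :=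
  Nat.sInf_le ⟨hp, h⟩

theorem hasPeriod_factor_iff {α : Type*} {f : ℕ → α} {i p c : ℕ} :
    (factor f i c).HasPeriod p ↔ RepeatsAt f i p (c - p) := by
  rw [List.hasPeriod_iff_getElem?, length_factor]
  refine forall₂_congr fun t ht => ?_
  rw [getElem?_factor f i (by lia), getElem?_factor f i (by lia), Option.some_inj, Nat.add_assoc]

end Period

section Bounds

variable {n : ℕ} {ε : ℚ} {E : Set ℕ} {p p' r r' : ℕ}

theorem chi_nonneg (E : Set ℕ) (k : ℕ) : 0 ≤ chi E k :=
  Set.indicator_nonneg (fun _ _ => zero_le_one) k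

theorem chi_le_one (E : Set ℕ) (k : ℕ) : chi E k ≤ 1 :=
  Set.indicator_le_self' (fun _ _ => zero_le_one) k

theorem chi_of_notMem (h : r ∉ E) : chi E r = 1 := by
  simp [chi, h]

/-- A repetition with root of length `p` and repeated part of length `r` is as long as an
`(ε, E)`-threshold word allows; this is `ExpBound n p r (ε * chi E r)` without division. -/
def RepBound (n : ℕ) (ε : ℚ) (E : Set ℕ) (p r : ℕ) : Prop :=
  ((n : ℚ) - 1) * (r + ε * chi E r) ≤ p

theorem expBound_iff (hn : 1 < n) (hp : 0 < p) (e : ℚ) :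
    ExpBound n p r e ↔ ((n : ℚ) - 1) * (r + e) ≤ p := by
  have hn' : (0 : ℚ) < n - 1 := sub_pos.2 (by exact_mod_cast hn)
  rw [ExpBound, div_le_div_iff₀ (by exact_mod_cast hp) hn']
  constructor <;> intro h <;> linarith

theorem RepBound.of_expBound (hn : 1 < n) (hp : 0 < p) (hpp' : p ≤ p')
    (h : ExpBound n p r (ε * chi E r)) : RepBound n ε E p' r :=
  ((expBound_iff hn hp _).1 h).trans (by exact_mod_cast hpp')

theorem RepBound.of_isExponential {x y : List (Fin n)} (hn : 1 < n) (hr : 0 < r)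
    (hx : x.length = r) (hp : (x ++ y).length ≤ p)
    (h : IsExponential x y (ε * chi E x.length)) : RepBound n ε E p r := by
  subst hx
  exact .of_expBound hn (by rw [List.length_append]; lia) hp h

theorem RepBound.of_add_eps_le (hn : 1 < n) (hε : 0 ≤ ε)
    (h : ((n : ℚ) - 1) * (r + ε) ≤ p) : RepBound n ε E p r := by
  have hn' : (0 : ℚ) ≤ n - 1 := sub_nonneg.2 (by exact_mod_cast hn.le)
  refine le_trans ?_ h
  gcongr
  exact mul_le_of_le_one_right hε (chi_le_one E r)

theorem RepBound.pred_mul_cast_le (hn : 1 < n) (hε : 0 ≤ ε) (h : RepBound n ε E p r) :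
    ((n : ℚ) - 1) * r ≤ p := by
  have hn' : (0 : ℚ) ≤ n - 1 := sub_nonneg.2 (by exact_mod_cast hn.le)
  refine le_trans ?_ h
  gcongr
  exact le_add_of_nonneg_right (mul_nonneg hε (chi_nonneg E r))

theorem RepBound.pred_mul_le (hn : 1 < n) (hε : 0 ≤ ε) (h : RepBound n ε E p r) :
    (n - 1) * r ≤ p := by
  have h' := h.pred_mul_cast_le hn hε
  rw [← Nat.cast_pred (by lia)] at h'
  exact_mod_cast h'

theorem RepBound.anti (hn : 1 < n) (hε : 0 ≤ ε) (hε₁ : ε ≤ 1) (hr : r' ≤ r)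
    (h : RepBound n ε E p r) : RepBound n ε E p r' := by
  rcases hr.eq_or_lt with rfl | hlt
  · exact h
  have hn' : (0 : ℚ) ≤ n - 1 := sub_nonneg.2 (by exact_mod_cast hn.le)
  have hr₁ : (r' : ℚ) + 1 ≤ r := by exact_mod_cast hlt
  refine .of_add_eps_le hn hε (le_trans ?_ (h.pred_mul_cast_le hn hε))
  gcongr
  linarith

/-- Every repetition in the first `N` letters of `f` obeys `RepBound`. -/
def RepBoundUpTo (ε : ℚ) (E : Set ℕ) (f : ℕ → Fin n) (N : ℕ) : Prop :=
  ∀ i p r, 0 < p → 0 < r → i + p + r ≤ N → RepeatsAt f i p r → RepBound n ε E p r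

variable {f : ℕ → Fin n} {N N' i k : ℕ}

theorem RepBoundUpTo.mono (h : RepBoundUpTo ε E f N) (hN : N' ≤ N) : RepBoundUpTo ε E f N' :=
  fun i p r hp hr hi => h i p r hp hr (hi.trans hN)

theorem RepBoundUpTo.isThreshold (hn : 1 < n) (hε : 0 ≤ ε) (h : RepBoundUpTo ε E f N)
    (hk : i + k ≤ N) : IsThreshold (factor f i k) := by
  rintro v hv ⟨s, t, hst⟩
  obtain ⟨hv_eq, hlen⟩ := eq_factor_of_append_eq hst
  obtain ⟨hp, hper⟩ := period_pos_and_hasPeriod hv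
  set p := period v
  have hn' : (0 : ℚ) < n - 1 := sub_pos.2 (by exact_mod_cast hn)
  rw [div_le_div_iff₀ (by exact_mod_cast hp) hn']
  rcases Nat.lt_or_ge p v.length with hpl | hpl
  · rw [hv_eq, hasPeriod_factor_iff] at hper
    have hb := (h _ p _ hp (by lia) (by lia) hper).pred_mul_cast_le hn hε
    rw [Nat.cast_sub hpl.le] at hb
    linarith
  · have hpl' : (v.length : ℚ) ≤ p := by exact_mod_cast hpl
    nlinarith

theorem RepBoundUpTo.isEpsThreshold (hn : 1 < n) (hε : 0 ≤ ε) (h : RepBoundUpTo ε E f N)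
    (hk : i + k ≤ N) : IsEpsThreshold ε E (factor f i k) := by
  refine ⟨h.isThreshold hn hε hk, fun x y hx ⟨s, t, hst⟩ hxE => ?_⟩
  have hx₀ : 0 < x.length := List.length_pos_iff.2 hx
  have hp : 0 < (x ++ y).length := by rw [List.length_append]; lia
  obtain ⟨hrep, hlen⟩ := repeatsAt_of_append_eq_factor hst
  have hb := h _ _ _ hp hx₀ (by lia) hrep
  rwa [RepBound, chi_of_notMem hxE, mul_one, ← expBound_iff hn hp] at hb

theorem RepBoundUpTo.pred_le_sub_of_eq {q q' : ℕ} (hn : 1 < n) (hε : 0 ≤ ε)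
    (h : RepBoundUpTo ε E f N) (hq : q < q') (hq' : q' < N) (he : f q = f q') :
    n - 1 ≤ q' - q := by
  have hrep : RepeatsAt f q (q' - q) 1 := by
    intro t ht
    obtain rfl : t = 0 := by lia
    rwa [add_zero, Nat.add_sub_cancel' hq.le]
  simpa using (h q (q' - q) 1 (by lia) one_pos (by lia) hrep).pred_mul_le hn hε

theorem RepBoundUpTo.ne_succ {q : ℕ} (hn : 2 < n) (hε : 0 ≤ ε) (h : RepBoundUpTo ε E f N)
    (hq : q + 1 < N) : f q ≠ f (q + 1) := fun he => by
  have := h.pred_le_sub_of_eq (by lia) hε (Nat.lt_succ_self q) hq he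
  lia

end Bounds

section CommonPrefix

variable {n : ℕ} {u v x : List (Fin n)}

theorem bddAbove_length_commonPrefix (u v : List (Fin n)) :
    BddAbove {k : ℕ | ∃ x : List (Fin n), x <+: u ∧ x <+: v ∧ x.length = k} :=
  ⟨u.length, by rintro _ ⟨x, h, -, rfl⟩; exact h.length_le⟩

theorem bddAbove_length_commonSuffix (u v : List (Fin n)) :
    BddAbove {k : ℕ | ∃ x : List (Fin n), x <:+ u ∧ x <:+ v ∧ x.length = k} :=
  ⟨u.length, by rintro _ ⟨x, h, -, rfl⟩; exact h.length_le⟩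

theorem length_le_lcp (hu : x <+: u) (hv : x <+: v) : x.length ≤ lcp u v :=
  le_csSup (bddAbove_length_commonPrefix u v) ⟨x, hu, hv, rfl⟩

theorem length_le_lcs (hu : x <:+ u) (hv : x <:+ v) : x.length ≤ lcs u v :=
  le_csSup (bddAbove_length_commonSuffix u v) ⟨x, hu, hv, rfl⟩

theorem lcp_le_length (u v : List (Fin n)) : lcp u v ≤ u.length :=
  csSup_le ⟨0, [], by simp⟩ (by rintro _ ⟨x, h, -, rfl⟩; exact h.length_le)

theorem lcs_le_length (u v : List (Fin n)) : lcs u v ≤ u.length :=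
  csSup_le ⟨0, [], by simp⟩ (by rintro _ ⟨x, h, -, rfl⟩; exact h.length_le)

end CommonPrefix

namespace ImageSystem

variable {n L : ℕ} {S : ImageSystem n L} {ε : ℚ} {E : Set ℕ} {a b : Fin n} {u v : List (Fin n)}

theorem bddAbove_lcp :
    BddAbove {k : ℕ | ∃ a b, a ≠ b ∧ ∃ u ∈ S.V a, ∃ v ∈ S.V b, k = lcp u v} :=
  ⟨L, by
    rintro _ ⟨a, b, -, u, hu, v, -, rfl⟩
    exact (lcp_le_length u v).trans (S.V_length a u hu).le⟩

theorem bddAbove_lcs :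
    BddAbove {k : ℕ | ∃ a b, a ≠ b ∧ ∃ u ∈ S.V a, ∃ v ∈ S.V b, k = lcs u v} :=
  ⟨L, by
    rintro _ ⟨a, b, -, u, hu, v, -, rfl⟩
    exact (lcs_le_length u v).trans (S.V_length a u hu).le⟩

theorem lcp_le_lcpV (hab : a ≠ b) (hu : u ∈ S.V a) (hv : v ∈ S.V b) : lcp u v ≤ S.lcpV :=
  le_csSup bddAbove_lcp ⟨a, b, hab, u, hu, v, hv, rfl⟩

theorem lcs_le_lcsV (hab : a ≠ b) (hu : u ∈ S.V a) (hv : v ∈ S.V b) : lcs u v ≤ S.lcsV :=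
  le_csSup bddAbove_lcs ⟨a, b, hab, u, hu, v, hv, rfl⟩

theorem exists_lcp_eq_lcpV (hn : 1 < n) :
    ∃ a b, a ≠ b ∧ ∃ u ∈ S.V a, ∃ v ∈ S.V b, S.lcpV = lcp u v := by
  obtain ⟨u, hu⟩ := S.V_nonempty ⟨0, by lia⟩
  obtain ⟨v, hv⟩ := S.V_nonempty ⟨1, hn⟩
  exact Nat.sSup_mem (s := {k | ∃ a b, a ≠ b ∧ ∃ u ∈ S.V a, ∃ v ∈ S.V b, k = lcp u v})
    ⟨_, ⟨0, by lia⟩, ⟨1, hn⟩, by simp, u, hu, v, hv, rfl⟩ bddAbove_lcp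

theorem head?_ne_of_lcpV_eq_zero (hL : 0 < L) (h₀ : S.lcpV = 0) (hab : a ≠ b) (hu : u ∈ S.V a)
    (hv : v ∈ S.V b) : u.head? ≠ v.head? := by
  intro he
  obtain ⟨c, u', rfl⟩ := List.exists_cons_of_length_pos (l := u) (by rwa [S.V_length a u hu])
  obtain ⟨v', rfl⟩ := List.head?_eq_some_iff.1 he.symm
  have hle := length_le_lcp (u := c :: u') (v := c :: v') (x := [c]) ⟨u', rfl⟩ ⟨v', rfl⟩
  have hle' := lcp_le_lcpV hab hu hv
  rw [List.length_singleton] at hle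
  lia

variable (S ε E) in
/-- The standing assumptions of the theorem on the parameters and on the images. -/
structure Admissible : Prop where
  five_le : 5 ≤ n
  one_lt : 1 < L
  consistent : S.Consistent ε E
  eps_mul : ε * ((L : ℚ) - 1) = (S.lcsV : ℚ) + (S.lcpV : ℚ)

namespace Admissible

variable (A : S.Admissible ε E)
include A

theorem one_lt_card : 1 < n := by
  have := A.five_le
  lia

theorem eps_nonneg : 0 ≤ ε := by
  have hL : (0 : ℚ) < L - 1 := sub_pos.2 (by exact_mod_cast A.one_lt)
  refine nonneg_of_mul_nonneg_left ?_ hL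
  rw [A.eps_mul]
  positivity

theorem ne_of_ne (hab : a ≠ b) (hu : u ∈ S.V a) (hv : v ∈ S.V b) : u ≠ v := by
  rintro rfl
  have hu₀ : u ≠ [] := List.ne_nil_of_length_pos (by have := A.one_lt; rw [S.V_length a u hu]; lia)
  exact A.consistent.uf12 a b hab u hu u hv u hu₀ (List.suffix_refl u) (List.prefix_refl u)

theorem lcsV_add_lcpV_add_eps_le : (S.lcsV : ℚ) + S.lcpV + ε ≤ L := by
  obtain ⟨a, b, hab, u, hu, v, hv, he⟩ := S.exists_lcp_eq_lcpV A.one_lt_card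
  have := (A.consistent.uf31 a b u hu v hv (A.ne_of_ne hab hu hv)).1
  rw [← he] at this
  linarith

theorem eps_le_one : ε ≤ 1 := by
  have hle := A.lcsV_add_lcpV_add_eps_le
  rw [← A.eps_mul] at hle
  have hL : (0 : ℚ) < L := by exact_mod_cast (zero_lt_one.trans A.one_lt)
  exact le_of_mul_le_mul_right (by linarith) hL

theorem head?_ne_getLast? (hu : u ∈ S.V a) : u.head? ≠ u.getLast? := by
  intro he
  have hL := A.one_lt
  have hlen := S.V_length a u hu
  have hper : u.HasPeriod (L - 1) := by
    rw [List.hasPeriod_iff_getElem?]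
    intro i hi
    obtain rfl : i = 0 := by lia
    rwa [Nat.zero_add, ← List.head?_eq_getElem?, ← hlen, ← List.getLast?_eq_getElem?]
  have := period_le (by lia) hper
  rw [A.consistent.uf11 a u hu] at this
  lia

theorem head?_ne_getLast?_of_ne (hab : a ≠ b) (hu : u ∈ S.V a) (hv : v ∈ S.V b) :
    v.head? ≠ u.getLast? := by
  intro he
  have hL := A.one_lt
  obtain ⟨c, v', rfl⟩ := List.exists_cons_of_length_pos (l := v) (by rw [S.V_length b v hv]; lia)
  obtain ⟨u', rfl⟩ := List.getLast?_eq_some_iff.1 he.symm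
  exact A.consistent.uf12 a b hab _ hu _ hv [c] (by simp) ⟨u', rfl⟩ ⟨v', rfl⟩

-- If `ε = 0` then `lcpV = 0`, so images of the `n` letters start with `n` different letters, and
-- one of these is the last letter of a given image.
theorem eps_pos : 0 < ε := by
  refine A.eps_nonneg.lt_of_ne fun h₀ => ?_
  have hL := A.one_lt
  have hlcp : S.lcpV = 0 := by
    have h := A.eps_mul
    rw [← h₀, zero_mul] at h
    have : S.lcsV + S.lcpV = 0 := by exact_mod_cast h.symm
    lia
  choose u hu using S.V_nonempty
  have hne : ∀ a, u a ≠ [] := fun a =>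
    List.ne_nil_of_length_pos (by rw [S.V_length a _ (hu a)]; lia)
  have hinj : Function.Injective fun a => (u a).head (hne a) := fun a b hab => by
    by_contra hne'
    refine head?_ne_of_lcpV_eq_zero (by lia) hlcp hne' (hu a) (hu b) ?_
    rw [List.head?_eq_some_head (hne a), List.head?_eq_some_head (hne b)]
    exact congrArg some hab
  let a : Fin n := ⟨0, by have := A.one_lt_card; lia⟩
  obtain ⟨b, hb⟩ := Finite.injective_iff_surjective.1 hinj ((u a).getLast (hne a))
  have hb' : (u b).head? = (u a).getLast? := by
    rw [List.head?_eq_some_head (hne b), List.getLast?_eq_some_getLast (hne a)]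
    exact congrArg some hb
  rcases eq_or_ne a b with rfl | hab
  · exact A.head?_ne_getLast? (hu a) hb'
  · exact A.head?_ne_getLast?_of_ne hab (hu a) (hu b) hb'

theorem repBound_of_lt {p r : ℕ} (hr : r < L) (hp : (n - 1) * L ≤ p) : RepBound n ε E p r := by
  have hn := A.one_lt_card
  have hn' : (0 : ℚ) ≤ n - 1 := sub_nonneg.2 (by exact_mod_cast hn.le)
  have hp' : ((n : ℚ) - 1) * L ≤ p := by
    rw [← Nat.cast_pred (by lia)]; exact_mod_cast hp
  have hr' : (r : ℚ) + 1 ≤ L := by exact_mod_cast hr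
  refine .of_add_eps_le hn A.eps_nonneg (le_trans ?_ hp')
  gcongr
  linarith [A.eps_le_one]

end Admissible

variable (S ε E) in
/-- `ψ` is a choice of images of the first `N` letters of the infinite word `g`; the finite version
of this notion is `IsSubstitution`. -/
structure IsSubstitutionUpTo (g : ℕ → Fin n) (ψ : ℕ → List (Fin n)) (N : ℕ) : Prop where
  mem : ∀ q < N, ψ q ∈ S.V (g q)
  follows : ∀ q, q + 1 < N → ψ (q + 1) ∈ S.δ (g (q + 1)) (ψ q)
  splits : ∀ i p r, 0 < p → 0 < r → i + p + r ≤ N → RepeatsAt g i p r → r ∈ E →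
    ¬ ((n : ℚ) - 1) * (r + ε) ≤ p → ∃ m < r, ψ (i + m) ≠ ψ (i + m + p)

variable {g : ℕ → Fin n} {ψ : ℕ → List (Fin n)} {f : ℕ → Fin n} {N i k : ℕ}

theorem IsSubstitutionUpTo.isSubstitution (hn : 1 < n) (h : S.IsSubstitutionUpTo ε E g ψ N)
    (hk : i + k ≤ N) : S.IsSubstitution ε E (factor g i k) (factor ψ i k) where
  length_eq := by simp
  mem_V := by
    intro j a u ha hu
    obtain ⟨hj, rfl⟩ := getElem?_factor_eq_some_iff.1 ha
    obtain ⟨-, rfl⟩ := getElem?_factor_eq_some_iff.1 hu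
    exact h.mem _ (by lia)
  follows := by
    intro j a u v ha hu hv
    obtain ⟨hj, rfl⟩ := getElem?_factor_eq_some_iff.1 ha
    obtain ⟨-, rfl⟩ := getElem?_factor_eq_some_iff.1 hu
    obtain ⟨-, rfl⟩ := getElem?_factor_eq_some_iff.1 hv
    exact h.follows (i + j) (by lia)
  splits := by
    intro l x y r hw hx hxE hexp
    have hx₀ : 0 < x.length := List.length_pos_iff.2 hx
    have hp : 0 < (x ++ y).length := by rw [List.length_append]; lia
    obtain ⟨hrep, hlen⟩ := repeatsAt_of_append_eq_factor hw.symm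
    rw [IsExponential, expBound_iff hn hp] at hexp
    obtain ⟨m, hm, hne⟩ := h.splits _ _ _ hp hx₀ (by lia) hrep hxE hexp
    refine ⟨m, hm, ?_⟩
    rw [getElem?_factor ψ _ (by lia), getElem?_factor ψ _ (by lia), Ne, Option.some_inj]
    simpa only [Nat.add_assoc] using hne

theorem gap_le (hn : 1 < n) (hε : 0 ≤ ε) (hg : RepBoundUpTo ε E g N)
    (h : S.IsSubstitutionUpTo ε E g ψ N) (hf : ∀ q < N, ψ q = factor f (q * L) L) {c c' : ℕ}
    (hN : i + c + k + c' ≤ N) :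
    S.gap ε E (factor f (i * L) (c * L)) (factor f ((i + c + k) * L) (c' * L)) ≤ k := by
  have hflat := flatten_factor (f := f) (i := i) (k := c + k + c') fun q _ hq => hf q (by lia)
  refine iInf₂_le k ⟨factor g i (c + k + c'), factor ψ i (c + k + c'),
    hg.isEpsThreshold hn hε (by lia), h.isSubstitution hn (by lia), ?_, ?_, ?_⟩
  · simp only [length_factor]; ring
  · rw [hflat]
    exact factor_prefix f _ (Nat.mul_le_mul_right L (by lia))
  · rw [hflat]
    exact factor_suffix f (by ring) (Nat.mul_le_mul_right L (by lia))

theorem GapBound.repBound (hn : 1 < n) {d : ℕ∞} {b r p : ℕ} (h : GapBound n L ε E d b r)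
    (hd : d ≤ k) (hb : 0 < b) (hp : p = k * L + b) : RepBound n ε E p r := by
  obtain ⟨m, rfl⟩ := ENat.ne_top_iff_exists.1 (ne_top_of_le_ne_top (ENat.natCast_ne_top k) hd)
  have hm := Nat.mul_le_mul_right L (show m ≤ k by exact_mod_cast hd)
  exact .of_expBound hn (by lia) (by lia) (h m rfl)

end ImageSystem

theorem exists_block_decomposition {L : ℕ} (hL : 0 < L) (i r : ℕ) :
    (∃ q, q * L ≤ i ∧ i + r ≤ (q + 1) * L ∧ r < L) ∨
      ∃ q m s t, s < L ∧ t < L ∧ i + s = q * L ∧ r = s + m * L + t ∧ (m = 0 → 0 < s ∧ 0 < t) := by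
  have hi := Nat.div_add_mod' i L
  have ho := Nat.mod_lt i hL
  set q := i / L
  set o := i % L
  by_cases hin : o + r ≤ L ∧ r < L
  · exact .inl ⟨q, by lia, by lia, hin.2⟩
  right
  rcases Nat.eq_zero_or_pos o with ho₀ | ho₀
  · have hr := Nat.div_add_mod' r L
    have hm : 0 < r / L := Nat.div_pos (by lia) hL
    exact ⟨q, r / L, 0, r % L, hL, Nat.mod_lt r hL, by lia, by lia, by lia⟩
  · have hr := Nat.div_add_mod' (r - (L - o)) L
    refine ⟨q + 1, (r - (L - o)) / L, L - o, (r - (L - o)) % L, by lia, Nat.mod_lt _ hL, by lia,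
      by lia, fun hm => ?_⟩
    rw [hm] at hr
    lia

theorem pred_mul_eq {n : ℕ} (hn : 1 < n) (L : ℕ) : (n - 1) * L = L * (n - 2) + L := by
  obtain ⟨m, rfl⟩ := Nat.exists_eq_add_of_le' hn
  simp only [Nat.add_sub_cancel, Nat.add_succ_sub_one]
  ring

namespace ImageSystem

variable {n L : ℕ} {S : ImageSystem n L} {ε : ℚ} {E : Set ℕ}

variable (S ε E) in
/-- `f` starts with the image of the first `N` letters of the `(ε, E)`-threshold word `g` under the
substitution `ψ`. -/
structure IsImage (g : ℕ → Fin n) (ψ : ℕ → List (Fin n)) (f : ℕ → Fin n) (N : ℕ) : Prop where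
  admissible : S.Admissible ε E
  repBoundUpTo : RepBoundUpTo ε E g N
  isSubstitutionUpTo : S.IsSubstitutionUpTo ε E g ψ N
  eq_factor : ∀ q < N, ψ q = factor f (q * L) L

namespace IsImage

variable {g : ℕ → Fin n} {ψ : ℕ → List (Fin n)} {f : ℕ → Fin n} {N : ℕ}
  {i k m p q q' r a a' b b' c s t : ℕ} (H : S.IsImage ε E g ψ f N)
include H

theorem one_lt_card : 1 < n := H.admissible.one_lt_card

theorem mem (hq : q < N) : factor f (q * L) L ∈ S.V (g q) :=
  H.eq_factor q hq ▸ H.isSubstitutionUpTo.mem q hq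

theorem follows (hq : q + 1 < N) :
    factor f ((q + 1) * L) L ∈ S.δ (g (q + 1)) (factor f (q * L) L) := by
  have := H.isSubstitutionUpTo.follows q hq
  rwa [H.eq_factor q (by lia), H.eq_factor (q + 1) hq] at this

theorem pred_le_sub_of_letter_eq (hq : q < q') (hq' : q' < N) (he : g q = g q') :
    n - 1 ≤ q' - q :=
  H.repBoundUpTo.pred_le_sub_of_eq H.one_lt_card H.admissible.eps_nonneg hq hq' he

theorem mul_add_pred_mul_le (hq : q < q') (hq' : q' < N) (he : g q = g q') :
    q * L + (n - 1) * L ≤ q' * L := by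
  have := H.pred_le_sub_of_letter_eq hq hq' he
  rw [← Nat.add_mul]
  exact Nat.mul_le_mul_right L (by lia)

theorem letter_ne_succ (hq : q + 1 < N) : g q ≠ g (q + 1) :=
  H.repBoundUpTo.ne_succ (by have := H.admissible.five_le; lia) H.admissible.eps_nonneg hq

theorem letter_eq_of_suffix_eq_prefix (hq : q < N) (hq' : q' < N) (hc : 0 < c) (hcL : c ≤ L)
    (hi : i + c = (q + 1) * L) (h : factor f i c = factor f (q' * L) c) : g q = g q' := by
  by_contra hne
  refine H.admissible.consistent.uf12 _ _ hne _ (H.mem hq) _ (H.mem hq') (factor f i c)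
    (factor_ne_nil f _ hc) (factor_suffix f (by lia) hcL) ?_
  rw [h]
  exact factor_prefix f _ hcL

theorem index_ne_of_suffix_eq_prefix (hq : q < N) (hc : 0 < c) (hcL : c < L)
    (hi : i + c = (q + 1) * L) (h : factor f i c = factor f (q' * L) c) : q ≠ q' := by
  rintro rfl
  have hrep : RepeatsAt f (q * L) (L - c) c := by
    rw [repeatsAt_iff_factor_eq, ← h]
    congr 1
    lia
  have hper : (factor f (q * L) L).HasPeriod (L - c) :=
    hasPeriod_factor_iff.2 (by rwa [Nat.sub_sub_self hcL.le])
  have := period_le (by lia) hper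
  rw [H.admissible.consistent.uf11 _ _ (H.mem hq)] at this
  lia

theorem repBound_of_gapBound {k c c' d : ℕ} (hN : i + c + k + c' ≤ N)
    (h : GapBound n L ε E
      (S.gap ε E (factor f (i * L) (c * L)) (factor f ((i + c + k) * L) (c' * L))) d r)
    (hd : 0 < d) (hp : p = k * L + d) : RepBound n ε E p r :=
  h.repBound H.one_lt_card (gap_le H.one_lt_card H.admissible.eps_nonneg H.repBoundUpTo
    H.isSubstitutionUpTo H.eq_factor hN) hd hp

theorem repBound_same_image (hq : q < N) (hr : 0 < r) (hrp : r ≤ p) (hi : q * L ≤ i)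
    (hip : i + p + r ≤ (q + 1) * L) (h : RepeatsAt f i p r) : RepBound n ε E p r := by
  have hx : factor f (i + p) r = factor f i r := h.factor_eq le_rfl rfl le_rfl
  have hxyx : factor f i (p + r) = factor f i r ++ factor f (i + r) (p - r) ++ factor f (i + p) r :=
    factor_eq_append₃ f rfl (by lia) (by lia)
  rw [hx] at hxyx
  have hs := H.admissible.consistent.uf210 _ _ (H.mem hq) _ _ (factor_ne_nil f _ hr)
    (hxyx ▸ factor_infix f hi (by lia))
  exact .of_isExponential H.one_lt_card hr (by simp) (by simp; lia) hs

theorem repBound_inside_inside (hq : q < q') (hq' : q' < N) (hr : 0 < r) (hrL : r < L)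
    (hi : q * L ≤ i) (hir : i + r ≤ (q + 1) * L) (hip : q' * L ≤ i + p)
    (hipr : i + p + r ≤ (q' + 1) * L) (h : RepeatsAt f i p r) : RepBound n ε E p r := by
  obtain ⟨k, rfl⟩ : ∃ k, q' = q + 1 + k := ⟨q' - q - 1, by lia⟩
  have hx : factor f (i + p) r = factor f i r := h.factor_eq le_rfl rfl le_rfl
  have hu : factor f (q * L) L = factor f (q * L) (i - q * L) ++ factor f i r ++
      factor f (i + r) ((q + 1) * L - (i + r)) :=
    factor_eq_append₃ f (by lia) rfl (by lia)
  have hv : factor f ((q + 1 + k) * L) L =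
      factor f ((q + 1 + k) * L) (i + p - (q + 1 + k) * L) ++ factor f (i + p) r ++
      factor f (i + p + r) ((q + 1 + k + 1) * L - (i + p + r)) :=
    factor_eq_append₃ f (by lia) rfl (by lia)
  rw [hx] at hv
  have hs := H.admissible.consistent.uf212 _ _ _ (H.mem (by lia)) _ (H.mem hq') _ _ _ _ _
    (factor_ne_nil f _ hr) (by simpa using hrL) hu hv
  simp only [List.length_append, length_factor] at hs
  exact H.repBound_of_gapBound (i := q) (k := k) (c := 1) (c' := 1) (by lia)
    (by simpa only [one_mul] using hs) (by lia) (by lia)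

theorem repBound_inside_cut_of_same_image (hq : q + 1 < N) (ha : 0 < a) (hb : 0 < b)
    (hrp : a + b ≤ p) (hi : q * L ≤ i) (hip : i + p + a = (q + 1) * L)
    (h : RepeatsAt f i p (a + b)) : RepBound n ε E p (a + b) := by
  have hx : factor f (i + p) a = factor f i a := h.factor_eq le_rfl rfl (by lia)
  have hy : factor f ((q + 1) * L) b = factor f (i + a) b :=
    h.factor_eq (by lia) (by lia) (by lia)
  have hu : factor f (q * L) L = factor f (q * L) (i - q * L) ++ factor f i a ++
      factor f (i + a) b ++ factor f (i + a + b) (p - a - b) ++ factor f (i + p) a :=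
    factor_eq_append₅ f (by lia) rfl rfl (by lia) (by lia)
  have hv : factor f ((q + 1) * L) L =
      factor f ((q + 1) * L) b ++ factor f ((q + 1) * L + b) (L - b) :=
    factor_eq_append f rfl (by lia)
  rw [hx] at hu
  rw [hy] at hv
  have hs := H.admissible.consistent.uf211 _ _ (H.letter_ne_succ hq) _ (H.mem (by lia)) _
    (H.follows hq) _ _ _ _ _ (factor_ne_nil f _ ha) (factor_ne_nil f _ hb) hu hv
  exact .of_isExponential H.one_lt_card (by lia) (by simp) (by simp; lia) hs

theorem repBound_cut_inside_of_succ_image (hq : q + 1 < N) (ha : 0 < a) (hb : 0 < b)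
    (hrp : a + b ≤ p) (hi : i + a = (q + 1) * L) (hipr : i + p + a + b ≤ (q + 2) * L)
    (h : RepeatsAt f i p (a + b)) : RepBound n ε E p (a + b) := by
  have hx : factor f (i + p) a = factor f i a := h.factor_eq le_rfl rfl (by lia)
  have hy : factor f (i + p + a) b = factor f ((q + 1) * L) b :=
    h.factor_eq (by lia) (by lia) (by lia)
  have hu : factor f (q * L) L = factor f (q * L) (L - a) ++ factor f i a :=
    factor_eq_append f (by lia) (by lia)
  have hv : factor f ((q + 1) * L) L = factor f ((q + 1) * L) b ++
      factor f ((q + 1) * L + b) (p - a - b) ++ factor f (i + p) a ++ factor f (i + p + a) b ++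
      factor f (i + p + a + b) ((q + 2) * L - (i + p + a + b)) :=
    factor_eq_append₅ f rfl (by lia) rfl rfl (by lia)
  rw [hx, hy] at hv
  have hs := H.admissible.consistent.uf213 _ _ (H.letter_ne_succ hq) _ (H.mem (by lia)) _
    (H.follows hq) _ _ _ _ _ (factor_ne_nil f _ ha) (factor_ne_nil f _ hb) hu hv
  exact .of_isExponential H.one_lt_card (by lia) (by simp) (by simp; lia) hs

theorem repBound_inside_cut_of_lt (hq : q < q') (hq' : q' + 1 < N) (ha : 0 < a) (hb : 0 < b)
    (hrL : a + b < L) (hi : q * L ≤ i) (hir : i + a + b ≤ (q + 1) * L)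
    (hip : i + p + a = (q' + 1) * L) (h : RepeatsAt f i p (a + b)) :
    RepBound n ε E p (a + b) := by
  by_cases hqq' : g q = g q'
  · have := H.mul_add_pred_mul_le hq (by lia) hqq'
    exact H.admissible.repBound_of_lt hrL (by lia)
  obtain ⟨k, rfl⟩ : ∃ k, q' = q + 1 + k := ⟨q' - q - 1, by lia⟩
  have hx : factor f (i + p) a = factor f i a := h.factor_eq le_rfl rfl (by lia)
  have hy : factor f ((q + 1 + k + 1) * L) b = factor f (i + a) b :=
    h.factor_eq (by lia) (by lia) (by lia)
  have hu : factor f (q * L) L = factor f (q * L) (i - q * L) ++ factor f i a ++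
      factor f (i + a) b ++ factor f (i + a + b) ((q + 1) * L - (i + a + b)) :=
    factor_eq_append₄ f (by lia) rfl rfl (by lia)
  have hv : factor f ((q + 1 + k) * L) L =
      factor f ((q + 1 + k) * L) (L - a) ++ factor f (i + p) a :=
    factor_eq_append f (by lia) (by lia)
  have hw : factor f ((q + 1 + k + 1) * L) L =
      factor f ((q + 1 + k + 1) * L) b ++ factor f ((q + 1 + k + 1) * L + b) (L - b) :=
    factor_eq_append f rfl (by lia)
  rw [hx] at hv
  rw [hy] at hw
  have hs := H.admissible.consistent.uf223 _ _ _ hqq' (H.letter_ne_succ hq') _ (H.mem (by lia)) _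
    (H.mem (by lia)) _ (H.mem hq') _ _ _ _ _ _ (factor_ne_nil f _ ha) (factor_ne_nil f _ hb)
    hu hv hw
  rw [← factor_eq_append f (c := 2 * L) (by lia) (by lia)] at hs
  simp only [List.length_append, length_factor] at hs
  exact H.repBound_of_gapBound (i := q) (k := k) (c := 1) (c' := 2) (by lia)
    (by simpa only [one_mul] using hs) (by lia) (by lia)

theorem repBound_cut_inside_of_lt (hq : q + 1 < q') (hq' : q' < N) (ha : 0 < a) (hb : 0 < b)
    (hrL : a + b < L) (hi : i + a = (q + 1) * L) (hip : q' * L ≤ i + p)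
    (hipr : i + p + a + b ≤ (q' + 1) * L) (h : RepeatsAt f i p (a + b)) :
    RepBound n ε E p (a + b) := by
  by_cases hqq' : g (q + 1) = g q'
  · have := H.mul_add_pred_mul_le hq hq' hqq'
    exact H.admissible.repBound_of_lt hrL (by lia)
  obtain ⟨k, rfl⟩ : ∃ k, q' = q + 2 + k := ⟨q' - q - 2, by lia⟩
  have hx : factor f (i + p) a = factor f i a := h.factor_eq le_rfl rfl (by lia)
  have hy : factor f (i + p + a) b = factor f ((q + 1) * L) b :=
    h.factor_eq (by lia) (by lia) (by lia)
  have hu : factor f (q * L) L = factor f (q * L) (L - a) ++ factor f i a :=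
    factor_eq_append f (by lia) (by lia)
  have hv : factor f ((q + 1) * L) L =
      factor f ((q + 1) * L) b ++ factor f ((q + 1) * L + b) (L - b) :=
    factor_eq_append f rfl (by lia)
  have hw : factor f ((q + 2 + k) * L) L = factor f ((q + 2 + k) * L) (i + p - (q + 2 + k) * L) ++
      factor f (i + p) a ++ factor f (i + p + a) b ++
      factor f (i + p + a + b) ((q + 2 + k + 1) * L - (i + p + a + b)) :=
    factor_eq_append₄ f (by lia) rfl rfl (by lia)
  rw [hx, hy] at hw
  have hs := H.admissible.consistent.uf221 _ _ _ (H.letter_ne_succ (by lia)) hqq' _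
    (H.mem (by lia)) _ (H.mem (by lia)) _ (H.mem hq') _ _ _ _ _ _ (factor_ne_nil f _ ha)
    (factor_ne_nil f _ hb) hu hv hw
  rw [← factor_eq_append f (c := 2 * L) (by lia) (by lia)] at hs
  simp only [List.length_append, length_factor] at hs
  exact H.repBound_of_gapBound (i := q) (k := k) (c := 2) (c' := 1) (by lia)
    (by simpa only [one_mul] using hs) (by lia) (by lia)

theorem repBound_cut_cut_of_lt (hp : 0 < p) (hq : q + 1 < N) (hq' : q' + 1 < N) (ha : 0 < a)
    (hb : 0 < b) (hc : 0 < c) (hab : a + b < L) (hbc : b + c < L) (hi : i + a = (q + 1) * L)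
    (hip : i + p + a + b = (q' + 1) * L) (h : RepeatsAt f i p (a + b + c)) :
    RepBound n ε E p (a + b + c) := by
  have hx : factor f (i + p) a = factor f i a := h.factor_eq le_rfl rfl (by lia)
  have hy : factor f (i + p + a) b = factor f ((q + 1) * L) b :=
    h.factor_eq (by lia) (by lia) (by lia)
  have hz : factor f ((q' + 1) * L) c = factor f ((q + 1) * L + b) c :=
    h.factor_eq (by lia) (by lia) (by lia)
  have hlt : q + 1 < q' + 1 := Nat.lt_of_mul_lt_mul_right (a := L) (by lia)
  have hne : q' ≠ q + 1 := H.index_ne_of_suffix_eq_prefix (by lia) hb (by lia) (by lia) hy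
  have hgq : g q' = g (q + 1) :=
    H.letter_eq_of_suffix_eq_prefix (by lia) hq hb (by lia) (by lia) hy
  have hle := H.mul_add_pred_mul_le (by lia) (by lia) hgq.symm
  rw [pred_mul_eq H.one_lt_card] at hle
  have hu₁ : factor f (q * L) L = factor f (q * L) (L - a) ++ factor f i a :=
    factor_eq_append f (by lia) (by lia)
  have hv₁ : factor f ((q + 1) * L) L = factor f ((q + 1) * L) b ++
      factor f ((q + 1) * L + b) c ++ factor f ((q + 1) * L + b + c) (L - b - c) :=
    factor_eq_append₃ f rfl rfl (by lia)
  have hu₂ : factor f (q' * L) L = factor f (q' * L) (L - a - b) ++ factor f (i + p) a ++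
      factor f (i + p + a) b :=
    factor_eq_append₃ f (by lia) rfl (by lia)
  have hv₂ : factor f ((q' + 1) * L) L =
      factor f ((q' + 1) * L) c ++ factor f ((q' + 1) * L + c) (L - c) :=
    factor_eq_append f rfl (by lia)
  rw [hx, hy] at hu₂
  rw [hz] at hv₂
  have hs := H.admissible.consistent.uf32 _ _ _ _ (H.letter_ne_succ hq) (H.letter_ne_succ hq') _
    (H.mem (by lia)) _ (H.follows hq) _ (H.mem (by lia)) _ (H.follows hq') _ _ _ _ _ _ _
    (factor_ne_nil f _ ha) (factor_ne_nil f _ hb) (factor_ne_nil f _ hc) hu₁ hv₁ hu₂ hv₂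
  simp only [List.length_append, length_factor] at hs
  exact .of_expBound H.one_lt_card (by lia) (by lia) hs

theorem repBound_cut_cut_of_gt (hp : 0 < p) (hq : q + 1 < N) (hq' : q' + 1 < N) (ha : 0 < a)
    (hb : 0 < b) (hc : 0 < c) (hab : a + b < L) (hbc : b + c < L)
    (hi : i + a + b = (q + 1) * L) (hip : i + p + a = (q' + 1) * L)
    (h : RepeatsAt f i p (a + b + c)) : RepBound n ε E p (a + b + c) := by
  have hx : factor f (i + p) a = factor f i a := h.factor_eq le_rfl rfl (by lia)
  have hy : factor f ((q' + 1) * L) b = factor f (i + a) b :=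
    h.factor_eq (by lia) (by lia) (by lia)
  have hz : factor f ((q' + 1) * L + b) c = factor f ((q + 1) * L) c :=
    h.factor_eq (by lia) (by lia) (by lia)
  have hlt : q < q' + 1 := Nat.lt_of_mul_lt_mul_right (a := L) (by lia)
  have hgq : g q = g (q' + 1) :=
    H.letter_eq_of_suffix_eq_prefix (by lia) hq' hb (by lia) (by lia) hy.symm
  have hle := H.mul_add_pred_mul_le hlt hq' hgq
  rw [pred_mul_eq H.one_lt_card] at hle
  have hu₁ : factor f (q' * L) L = factor f (q' * L) (L - a) ++ factor f (i + p) a :=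
    factor_eq_append f (by lia) (by lia)
  have hv₁ : factor f ((q' + 1) * L) L = factor f ((q' + 1) * L) b ++
      factor f ((q' + 1) * L + b) c ++ factor f ((q' + 1) * L + b + c) (L - b - c) :=
    factor_eq_append₃ f rfl rfl (by lia)
  have hu₂ : factor f (q * L) L = factor f (q * L) (L - a - b) ++ factor f i a ++
      factor f (i + a) b :=
    factor_eq_append₃ f (by lia) rfl (by lia)
  have hv₂ : factor f ((q + 1) * L) L =
      factor f ((q + 1) * L) c ++ factor f ((q + 1) * L + c) (L - c) :=
    factor_eq_append f rfl (by lia)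
  rw [hx] at hu₁
  rw [hy, hz] at hv₁
  have hs := H.admissible.consistent.uf32 _ _ _ _ (H.letter_ne_succ hq') (H.letter_ne_succ hq) _
    (H.mem (by lia)) _ (H.follows hq') _ (H.mem (by lia)) _ (H.follows hq) _ _ _ _ _ _ _
    (factor_ne_nil f _ ha) (factor_ne_nil f _ hb) (factor_ne_nil f _ hc) hu₁ hv₁ hu₂ hv₂
  simp only [List.length_append, length_factor] at hs
  exact .of_expBound H.one_lt_card (by lia) (by lia) hs

theorem dvd_of_factor_eq (hq : q < N) (hj : j + L ≤ N * L)
    (h : factor f (q * L) L = factor f j L) : L ∣ j := by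
  have hL := H.admissible.one_lt
  by_contra hdvd
  have ho : 0 < j % L := Nat.pos_of_ne_zero fun h₀ => hdvd (Nat.dvd_of_mod_eq_zero h₀)
  have hoL : j % L < L := Nat.mod_lt _ (by lia)
  have hj_eq : j / L * L + j % L = j := Nat.div_add_mod' j L
  set m := j / L
  set o := j % L
  have hm : m + 1 < N := Nat.lt_of_mul_lt_mul_right (a := L) (by lia)
  rw [factor_eq_factor_iff] at h
  have hleft : factor f j (L - o) = factor f (q * L) (L - o) :=
    factor_eq_factor_iff.2 fun t ht => (h t (by lia)).symm
  have hright : factor f (q * L + (L - o)) o = factor f ((m + 1) * L) o := by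
    refine factor_eq_factor_iff.2 fun t ht => ?_
    rw [Nat.add_assoc, h (L - o + t) (by lia)]
    congr 1
    lia
  have h₁ : g m = g q :=
    H.letter_eq_of_suffix_eq_prefix (by lia) hq (by lia) (by lia) (by lia) hleft
  have h₂ : g q = g (m + 1) :=
    H.letter_eq_of_suffix_eq_prefix hq hm ho hoL.le (by lia) hright
  exact H.letter_ne_succ hm (h₁.trans h₂)

theorem inside_or_cut (hj : j + r ≤ N * L) (hk : k + r ≤ N * L)
    (h : factor f j r = factor f k r) (hjk : ¬ j ≡ k [MOD L]) :
    (∃ q, q * L ≤ j ∧ j + r ≤ (q + 1) * L ∧ r < L) ∨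
      ∃ q a b, 0 < a ∧ 0 < b ∧ a < L ∧ b < L ∧ j + a = (q + 1) * L ∧ r = a + b := by
  have hL := H.admissible.one_lt
  refine (exists_block_decomposition (by lia) j r).imp_right ?_
  rintro ⟨q, m, s, t, hs, ht, hq, hr, hst⟩
  rcases Nat.eq_zero_or_pos m with rfl | hm
  · obtain ⟨hs₀, ht₀⟩ := hst rfl
    obtain ⟨q, rfl⟩ : ∃ q₀, q = q₀ + 1 :=
      Nat.exists_eq_succ_of_ne_zero (by rintro rfl; lia)
    exact ⟨q, s, t, hs₀, ht₀, hs, ht, hq, by lia⟩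
  · have hmL : L ≤ m * L := Nat.le_mul_of_pos_left L hm
    rw [factor_eq_factor_iff] at h
    have hblock : factor f (q * L) L = factor f (k + s) L := by
      refine factor_eq_factor_iff.2 fun x hx => ?_
      rw [← hq, Nat.add_assoc, h (s + x) (by lia), Nat.add_assoc]
    have hqN : q < N := Nat.lt_of_mul_lt_mul_right (a := L) (by lia)
    have hdvd : L ∣ k + s := H.dvd_of_factor_eq hqN (by lia) hblock
    refine absurd (Nat.ModEq.add_right_cancel' s ?_) hjk
    rw [hq]
    exact (Nat.modEq_zero_iff_dvd.2 (Nat.dvd_mul_left L q)).trans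
      (Nat.modEq_zero_iff_dvd.2 hdvd).symm

theorem repBound_cut_cut (hp : 0 < p) (hq : q + 1 < N) (hq' : q' + 1 < N) (ha : 0 < a)
    (hb : 0 < b) (ha' : 0 < a') (hb' : 0 < b') (haL : a < L) (hbL : b < L) (ha'L : a' < L)
    (hb'L : b' < L) (hr : r = a + b) (hr' : r = a' + b') (hi : i + a = (q + 1) * L)
    (hip : i + p + a' = (q' + 1) * L) (hne : a ≠ a') (h : RepeatsAt f i p r) :
    RepBound n ε E p r := by
  rcases Nat.lt_or_gt_of_ne hne with hlt | hlt
  · obtain rfl : r = a + (a' - a) + b' := by lia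
    exact H.repBound_cut_cut_of_lt hp hq hq' ha (by lia) hb' (by lia) (by lia) hi (by lia) h
  · obtain rfl : r = a' + (a - a') + b := by lia
    exact H.repBound_cut_cut_of_gt hp hq hq' ha' (by lia) hb (by lia) (by lia) (by lia) hip h

theorem repBound_of_not_dvd (hr : 0 < r) (hrp : r ≤ p) (hi : i + p + r ≤ N * L) (hdvd : ¬ L ∣ p)
    (h : RepeatsAt f i p r) : RepBound n ε E p r := by
  have hlt {x y : ℕ} (hxy : x * L < y * L) : x < y := Nat.lt_of_mul_lt_mul_right hxy
  have heq := repeatsAt_iff_factor_eq.1 h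
  have hmod : ¬ i ≡ i + p [MOD L] := fun hm => hdvd <| by
    simpa using (Nat.modEq_iff_dvd' (Nat.le_add_right i p)).1 hm
  rcases H.inside_or_cut (by lia) hi heq hmod with
    ⟨q, hqi, hqr, hrL⟩ | ⟨q, a, b, ha, hb, haL, hbL, hqi, hab⟩ <;>
  rcases H.inside_or_cut hi (by lia) heq.symm (fun hm => hmod hm.symm) with
    ⟨q', hqi', hqr', hrL'⟩ | ⟨q', a', b', ha', hb', haL', hbL', hqi', hab'⟩
  · have hqN : q' < N := hlt (by lia)
    rcases (Nat.lt_succ_iff.1 (hlt (y := q' + 1) (by lia)) : q ≤ q').eq_or_lt with rfl | hqq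
    · exact H.repBound_same_image hqN hr hrp hqi hqr' h
    · exact H.repBound_inside_inside hqq hqN hr hrL hqi hqr hqi' hqr' h
  · subst hab'
    have hqN : q' + 1 < N := hlt (by lia)
    rcases (Nat.lt_succ_iff.1 (hlt (y := q' + 1) (by lia)) : q ≤ q').eq_or_lt with rfl | hqq
    · exact H.repBound_inside_cut_of_same_image hqN ha' hb' hrp hqi hqi' h
    · exact H.repBound_inside_cut_of_lt hqq hqN ha' hb' hrL hqi (by lia) hqi' h
  · subst hab
    have hqN : q' < N := hlt (by lia)
    rcases (Nat.lt_succ_iff.1 (hlt (y := q' + 1) (by lia)) : q + 1 ≤ q').eq_or_lt with rfl | hqq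
    · exact H.repBound_cut_inside_of_succ_image hqN ha hb hrp hqi (by lia) h
    · exact H.repBound_cut_inside_of_lt hqq hqN ha hb hrL' hqi hqi' (by lia) h
  · refine H.repBound_cut_cut (hr.trans_le hrp) (hlt (by lia)) (hlt (by lia)) ha hb ha' hb' haL hbL
      haL' hbL' hab hab' hqi hqi' ?_ h
    rintro rfl
    have hsum : (q + 1) * L + p = (q' + 1) * L := by lia
    exact hdvd ((Nat.dvd_add_right (Nat.dvd_mul_left L (q + 1))).1 (hsum ▸ Nat.dvd_mul_left L _))

theorem repBound_same_cut_of_succ_image (hq : q + 2 < N) (ha : 0 < a) (hb : 0 < b) (hab : a + b ≤ L)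
    (hi : i + a = (q + 1) * L) (h : RepeatsAt f i L (a + b)) : RepBound n ε E L (a + b) := by
  have hx : factor f (i + L) a = factor f i a := h.factor_eq le_rfl rfl (by lia)
  have hy : factor f ((q + 2) * L) b = factor f ((q + 1) * L) b :=
    h.factor_eq (by lia) (by lia) (by lia)
  have hne : g (q + 2) ≠ g q := fun he => by
    have := H.pred_le_sub_of_letter_eq (by lia : q < q + 2) hq he.symm
    have := H.admissible.five_le
    lia
  have hu : factor f (q * L) L = factor f (q * L) (L - a) ++ factor f i a :=
    factor_eq_append f (by lia) (by lia)
  have hv : factor f ((q + 1) * L) L = factor f ((q + 1) * L) b ++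
      factor f ((q + 1) * L + b) (L - a - b) ++ factor f (i + L) a :=
    factor_eq_append₃ f rfl (by lia) (by lia)
  have hw : factor f ((q + 2) * L) L =
      factor f ((q + 2) * L) b ++ factor f ((q + 2) * L + b) (L - b) :=
    factor_eq_append f rfl (by lia)
  rw [hx] at hv
  rw [hy] at hw
  have hs := H.admissible.consistent.uf222 _ _ _ (H.letter_ne_succ (by lia)) (H.letter_ne_succ hq)
    hne _ (H.mem (by lia)) _ (H.follows (by lia)) _ (H.follows hq) _ _ _ _ _
    (factor_ne_nil f _ ha) (factor_ne_nil f _ hb) hu hv hw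
  exact .of_isExponential H.one_lt_card (by lia) (by simp) (by simp; lia) hs

theorem repBound_same_cut_of_letter_ne (hq : q + 2 + k + 1 < N) (ha : 0 < a) (hb : 0 < b)
    (haL : a ≤ L) (hbL : b ≤ L) (hi : i + a = (q + 1) * L) (hp : p = (k + 2) * L)
    (hne : g q ≠ g (q + 2 + k)) (hne' : g (q + 1) ≠ g (q + 2 + k + 1))
    (h : RepeatsAt f i p (a + b)) : RepBound n ε E p (a + b) := by
  have hx : factor f (i + p) a = factor f i a := h.factor_eq le_rfl rfl (by lia)
  have hy : factor f ((q + 2 + k + 1) * L) b = factor f ((q + 1) * L) b :=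
    h.factor_eq (by lia) (by lia) (by lia)
  have hu₁ : factor f (q * L) L = factor f (q * L) (L - a) ++ factor f i a :=
    factor_eq_append f (by lia) (by lia)
  have hv₁ : factor f ((q + 1) * L) L =
      factor f ((q + 1) * L) b ++ factor f ((q + 1) * L + b) (L - b) :=
    factor_eq_append f rfl (by lia)
  have hu₂ : factor f ((q + 2 + k) * L) L =
      factor f ((q + 2 + k) * L) (L - a) ++ factor f (i + p) a :=
    factor_eq_append f (by lia) (by lia)
  have hv₂ : factor f ((q + 2 + k + 1) * L) L =
      factor f ((q + 2 + k + 1) * L) b ++ factor f ((q + 2 + k + 1) * L + b) (L - b) :=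
    factor_eq_append f rfl (by lia)
  rw [hx] at hu₂
  rw [hy] at hv₂
  have hs := H.admissible.consistent.uf23 _ _ _ _ (H.letter_ne_succ (by lia)) (H.letter_ne_succ hq)
    hne hne' _ (H.mem (by lia)) _ (H.follows (by lia)) _ (H.mem (by lia)) _ (H.follows hq)
    _ _ _ _ _ _ (factor_ne_nil f _ ha) (factor_ne_nil f _ hb) hu₁ hv₁ hu₂ hv₂
  rw [← factor_eq_append f (c := 2 * L) (by lia) (by lia),
    ← factor_eq_append f (c := 2 * L) (by lia) (by lia)] at hs
  simp only [List.length_append, length_factor] at hs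
  exact H.repBound_of_gapBound (i := q) (k := k) (c := 2) (c' := 2) (by lia) hs (by lia) (by lia)

theorem repBound_of_letters_repeat (hk : 0 < k) (hm : 0 < m) (hN : q + k + m ≤ N)
    (h : RepeatsAt g q k m) (hr : (r : ℚ) + ε ≤ m * L) : RepBound n ε E (k * L) r := by
  have hn' : (0 : ℚ) ≤ n - 1 := sub_nonneg.2 (by exact_mod_cast H.one_lt_card.le)
  have hε := H.admissible.eps_nonneg
  have hle := (H.repBoundUpTo q k m hk hm hN h).pred_mul_cast_le H.one_lt_card hε
  refine .of_add_eps_le H.one_lt_card hε ?_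
  calc ((n : ℚ) - 1) * (r + ε) ≤ (n - 1) * (m * L) := by gcongr
    _ = (n - 1) * m * L := by ring
    _ ≤ k * L := by gcongr
    _ = (k * L : ℕ) := by push_cast; rfl

theorem letters_repeat_of_images_repeat (hN : q + k + m ≤ N) (h : RepeatsAt ψ q k m) :
    RepeatsAt g q k m := by
  intro t ht
  refine H.letter_eq_of_suffix_eq_prefix (by lia) (by lia) (by have := H.admissible.one_lt; lia)
    le_rfl (Nat.succ_mul (q + t) L).symm ?_
  rw [← H.eq_factor _ (by lia), ← H.eq_factor _ (by lia)]
  exact h t ht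

theorem pred_mul_add_eps_le_of_images_repeat (hk : 0 < k) (hm : 0 < m) (hN : q + k + m ≤ N)
    (h : RepeatsAt ψ q k m) : ((n : ℚ) - 1) * (m + ε) ≤ k := by
  have hg := H.letters_repeat_of_images_repeat hN h
  by_cases hmE : m ∈ E
  · by_contra hlt
    obtain ⟨j, hj, hne⟩ := H.isSubstitutionUpTo.splits q k m hk hm hN hg hmE hlt
    exact hne (h j hj)
  · have := H.repBoundUpTo q k m hk hm hN hg
    rwa [RepBound, chi_of_notMem hmE, mul_one] at this

-- The assumption `ε * (L - 1) = lcsV + lcpV` gives `r + ε ≤ (m + ε) * L`.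
theorem repBound_of_images_repeat (hk : 0 < k) (hm : 0 < m) (hN : q + k + m ≤ N)
    (h : RepeatsAt ψ q k m) (hr : r ≤ m * L + S.lcsV + S.lcpV) : RepBound n ε E (k * L) r := by
  have hn' : (0 : ℚ) ≤ n - 1 := sub_nonneg.2 (by exact_mod_cast H.one_lt_card.le)
  have hle := H.pred_mul_add_eps_le_of_images_repeat hk hm hN h
  have hr' : (r : ℚ) ≤ m * L + S.lcsV + S.lcpV := by exact_mod_cast hr
  refine .of_add_eps_le H.one_lt_card H.admissible.eps_nonneg ?_
  calc ((n : ℚ) - 1) * (r + ε) ≤ (n - 1) * ((m + ε) * L) := by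
        gcongr
        linarith [H.admissible.eps_mul]
    _ = (n - 1) * (m + ε) * L := by ring
    _ ≤ k * L := by gcongr
    _ = (k * L : ℕ) := by push_cast; rfl

theorem images_repeat_of_repeatsAt (hN : q + k + m ≤ N) (h : RepeatsAt f (q * L) (k * L) (m * L)) :
    RepeatsAt ψ q k m := by
  intro t ht
  have hle : (t + 1) * L ≤ m * L := Nat.mul_le_mul_right L ht
  rw [H.eq_factor _ (by lia), H.eq_factor _ (by lia)]
  exact (h.factor_eq (by lia) (by lia) (by lia)).symm

theorem le_lcsV_of_letter_ne (hN : q + k < N) (hs : s ≤ L) (hi : i + s = (q + 1) * L)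
    (h : RepeatsAt f i (k * L) s) (hne : g q ≠ g (q + k)) : s ≤ S.lcsV := by
  have hle := length_le_lcs (factor_suffix f (i := q * L) (c := L) (by lia) hs)
    (h.factor_eq le_rfl rfl le_rfl ▸ factor_suffix f (i := (q + k) * L) (c := L) (by lia) hs)
  rw [length_factor] at hle
  exact hle.trans (lcs_le_lcsV hne (H.mem (by lia)) (H.mem hN))

theorem le_lcpV_of_letter_ne (hN : q + k < N) (ht : t ≤ L) (h : RepeatsAt f (q * L) (k * L) t)
    (hne : g q ≠ g (q + k)) : t ≤ S.lcpV := by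
  have hle := length_le_lcp (factor_prefix f (q * L) ht)
    (h.factor_eq le_rfl (Nat.add_mul q k L) le_rfl ▸ factor_prefix f ((q + k) * L) ht)
  rw [length_factor] at hle
  exact hle.trans (lcp_le_lcpV hne (H.mem (by lia)) (H.mem hN))

theorem add_lcpV_add_eps_le_of_image_ne (hN : q + k < N) (hs : s ≤ L) (hi : i + s = (q + 1) * L)
    (h : RepeatsAt f i (k * L) s) (hne : ψ q ≠ ψ (q + k)) : (s : ℚ) + S.lcpV + ε ≤ L := by
  rw [H.eq_factor _ (by lia), H.eq_factor _ hN] at hne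
  have hle := length_le_lcs (factor_suffix f (i := q * L) (c := L) (by lia) hs)
    (h.factor_eq le_rfl rfl le_rfl ▸ factor_suffix f (i := (q + k) * L) (c := L) (by lia) hs)
  rw [length_factor] at hle
  have hle' : (s : ℚ) ≤ lcs (factor f (q * L) L) (factor f ((q + k) * L) L) := by exact_mod_cast hle
  linarith [(H.admissible.consistent.uf31 _ _ _ (H.mem (by lia)) _ (H.mem hN) hne).2]

theorem add_lcsV_add_eps_le_of_image_ne (hN : q + k < N) (ht : t ≤ L)
    (h : RepeatsAt f (q * L) (k * L) t) (hne : ψ q ≠ ψ (q + k)) : (t : ℚ) + S.lcsV + ε ≤ L := by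
  rw [H.eq_factor _ (by lia), H.eq_factor _ hN] at hne
  have hle := length_le_lcp (factor_prefix f (q * L) ht)
    (h.factor_eq le_rfl (Nat.add_mul q k L) le_rfl ▸ factor_prefix f ((q + k) * L) ht)
  rw [length_factor] at hle
  have hle' : (t : ℚ) ≤ lcp (factor f (q * L) L) (factor f ((q + k) * L) L) := by exact_mod_cast hle
  linarith [(H.admissible.consistent.uf31 _ _ _ (H.mem (by lia)) _ (H.mem hN) hne).1]

theorem eq_of_image_eq (hN : q + k < N) (h : ψ q = ψ (q + k)) (ht : t < L) :
    f (q * L + t) = f (q * L + t + k * L) := by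
  rw [H.eq_factor _ (by lia), H.eq_factor _ hN, factor_eq_factor_iff] at h
  rw [h t ht]
  congr 1
  lia

theorem left_overhang_le_or_extend (M : IsMaximalRepetition f (N * L) i (k * L) r) (hs : s < L)
    (hsr : s ≤ r) (hi : i + s = q * L) (hN : q + k ≤ N) (h : RepeatsAt g q k m) :
    s ≤ S.lcsV ∨
      ∃ q₀, q = q₀ + 1 ∧ RepeatsAt g q₀ k (m + 1) ∧ (s : ℚ) + S.lcpV + ε ≤ L := by
  rcases Nat.eq_zero_or_pos s with rfl | hs₀
  · exact .inl (Nat.zero_le _)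
  obtain ⟨q, rfl⟩ : ∃ q₀, q = q₀ + 1 := Nat.exists_eq_succ_of_ne_zero (by rintro rfl; lia)
  have hrep : RepeatsAt f i (k * L) s := M.repeatsAt.mono hsr
  by_cases hg : g q = g (q + k)
  · refine .inr ⟨q, rfl, h.extend_left hg,
      H.add_lcpV_add_eps_le_of_image_ne (by lia) hs.le hi hrep fun heq => M.left (by lia) ?_⟩
    have := H.eq_of_image_eq (by lia) heq (t := L - s - 1) (by lia)
    rwa [show q * L + (L - s - 1) = i - 1 by lia] at this
  · exact .inl (H.le_lcsV_of_letter_ne (by lia) hs.le hi hrep hg)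

theorem right_overhang_le_or_extend (M : IsMaximalRepetition f (N * L) i (k * L) r) (ht : t < L)
    (htr : t ≤ r) (hi : i + r = (q + m) * L + t) (h : RepeatsAt g q k m) :
    t ≤ S.lcpV ∨
      q + k + (m + 1) ≤ N ∧ RepeatsAt g q k (m + 1) ∧ (t : ℚ) + S.lcsV + ε ≤ L := by
  rcases Nat.eq_zero_or_pos t with rfl | ht₀
  · exact .inl (Nat.zero_le _)
  have hM := M.le
  have hN : q + m + k < N := Nat.lt_of_mul_lt_mul_right (a := L) (by lia)
  have hNL : (q + m + k + 1) * L ≤ N * L := Nat.mul_le_mul_right L hN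
  have hrep : RepeatsAt f ((q + m) * L) (k * L) t :=
    repeatsAt_iff_factor_eq.2 (M.repeatsAt.factor_eq (by lia) rfl (by lia)).symm
  by_cases hg : g (q + m) = g (q + m + k)
  · refine .inr ⟨by lia, h.extend_right hg,
      H.add_lcsV_add_eps_le_of_image_ne hN ht.le hrep fun heq => M.right (by lia) ?_⟩
    rw [hi]
    exact H.eq_of_image_eq hN heq ht
  · exact .inl (H.le_lcpV_of_letter_ne hN ht.le hrep hg)

theorem repBound_same_cut (hk : 0 < k) (hN : q + k + 1 < N) (ha : 0 < a) (hb : 0 < b)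
    (ha' : a ≤ S.lcsV) (hb' : b ≤ S.lcpV) (hi : i + a = (q + 1) * L)
    (h : RepeatsAt f i (k * L) (a + b)) : RepBound n ε E (k * L) (a + b) := by
  have hlc := H.admissible.lcsV_add_lcpV_add_eps_le
  have hab : (a : ℚ) + b ≤ S.lcsV + S.lcpV := by exact_mod_cast Nat.add_le_add ha' hb'
  by_cases hg : g q = g (q + k)
  · exact H.repBound_of_letters_repeat (q := q) (m := 1) hk one_pos (by lia)
      (RepeatsAt.extend_right (r := 0) (fun _ ht => absurd ht (Nat.not_lt_zero _)) hg)
      (by push_cast; linarith)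
  by_cases hg' : g (q + 1) = g (q + 1 + k)
  · exact H.repBound_of_letters_repeat (q := q + 1) (m := 1) hk one_pos (by lia)
      (RepeatsAt.extend_right (r := 0) (fun _ ht => absurd ht (Nat.not_lt_zero _)) hg')
      (by push_cast; linarith)
  have habL : a + b ≤ L := by
    have : (a : ℚ) + b ≤ L := by linarith [H.admissible.eps_nonneg]
    exact_mod_cast this
  obtain rfl | ⟨k, rfl⟩ : k = 1 ∨ ∃ l, k = l + 2 := by
    rcases k with _ | _ | k
    exacts [absurd hk (lt_irrefl 0), .inl rfl, .inr ⟨k, rfl⟩]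
  · rw [one_mul] at h ⊢
    exact H.repBound_same_cut_of_succ_image hN ha hb habL hi h
  · exact H.repBound_same_cut_of_letter_ne (q := q) (k := k) (by lia) ha hb (by lia) (by lia) hi rfl
      (by rwa [show q + 2 + k = q + (k + 2) by lia])
      (by rwa [show q + 2 + k + 1 = q + 1 + (k + 2) by lia]) h

theorem repBound_of_isMaximalRepetition (hk : 0 < k) (hr : 0 < r)
    (M : IsMaximalRepetition f (N * L) i (k * L) r) : RepBound n ε E (k * L) r := by
  have hL := H.admissible.one_lt
  have hM := M.le
  have hε := H.admissible.eps_nonneg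
  rcases exists_block_decomposition (L := L) (by lia) i r with
    ⟨q, hqi, hqr, hrL⟩ | ⟨q, m, s, t, hs, ht, hq, hr_eq, hst⟩
  · exact H.repBound_inside_inside (q' := q + k) (by lia)
      (Nat.lt_of_mul_lt_mul_right (a := L) (by lia)) hr hrL hqi hqr (by lia) (by lia) M.repeatsAt
  have hN : q + k + m ≤ N := Nat.le_of_mul_le_mul_right (c := L) (by lia) (by lia)
  have hψ : RepeatsAt ψ q k m := H.images_repeat_of_repeatsAt hN <|
    repeatsAt_iff_factor_eq.2 (M.repeatsAt.factor_eq (by lia) rfl (by lia)).symm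
  have hg := H.letters_repeat_of_images_repeat hN hψ
  have hr_cast : (r : ℚ) = s + m * L + t := by exact_mod_cast hr_eq
  rcases H.left_overhang_le_or_extend M hs (by lia) hq (by lia) hg with hs' | ⟨q, rfl, hg₀, hs'⟩
  · have hs_cast : (s : ℚ) ≤ S.lcsV := by exact_mod_cast hs'
    rcases H.right_overhang_le_or_extend M ht (by lia) (by lia) hg with ht' | ⟨hN', hg₁, ht'⟩
    · rcases Nat.eq_zero_or_pos m with rfl | hm
      · obtain ⟨hs₀, ht₀⟩ := hst rfl
        obtain ⟨q, rfl⟩ : ∃ q₀, q = q₀ + 1 :=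
          Nat.exists_eq_succ_of_ne_zero (by rintro rfl; lia)
        obtain rfl : r = s + t := by lia
        have hqN : q + k + 1 < N := Nat.lt_of_mul_lt_mul_right (a := L) (by lia)
        exact H.repBound_same_cut hk hqN hs₀ ht₀ hs' ht' hq M.repeatsAt
      · exact H.repBound_of_images_repeat hk hm hN hψ (by lia)
    · exact H.repBound_of_letters_repeat hk m.succ_pos hN' hg₁ (by push_cast; linarith)
  · rcases H.right_overhang_le_or_extend M ht (by lia) (by lia) hg₀ with ht' | ⟨hN', hg₁, ht'⟩
    · have ht_cast : (t : ℚ) ≤ S.lcpV := by exact_mod_cast ht'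
      exact H.repBound_of_letters_repeat hk m.succ_pos (by lia) hg₀ (by push_cast; linarith)
    · exact H.repBound_of_letters_repeat hk (m + 1).succ_pos hN' hg₁ (by push_cast; linarith)

theorem repBoundUpTo_image : RepBoundUpTo ε E f (N * L) := by
  have hn := H.one_lt_card
  have hε := H.admissible.eps_nonneg
  intro i p r hp hr hi h
  by_cases hdvd : L ∣ p
  · obtain ⟨k, rfl⟩ := exists_eq_mul_left_of_dvd hdvd
    obtain ⟨i', r', hr', M⟩ := h.exists_isMaximalRepetition hi
    exact (H.repBound_of_isMaximalRepetition (Nat.pos_of_mul_pos_right hp) (by lia) M).anti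
      hn hε H.admissible.eps_le_one hr'
  rcases Nat.lt_or_ge p r with hlt | hle
  · have hpp := (H.repBound_of_not_dvd hp le_rfl (by lia) hdvd (h.mono hlt.le)).pred_mul_le hn hε
    have := Nat.mul_le_mul_right p (show 2 ≤ n - 1 by have := H.admissible.five_le; lia)
    lia
  · exact H.repBound_of_not_dvd hr hle hi hdvd h

end IsImage

end ImageSystem

theorem exists_eq_factor_of_length_eq {α : Type*} [Nonempty α] {ψ : ℕ → List α} {N L : ℕ}
    (h : ∀ q < N, (ψ q).length = L) : ∃ f : ℕ → α, ∀ q < N, ψ q = factor f (q * L) L := by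
  obtain ⟨a⟩ := ‹Nonempty α›
  refine ⟨fun i => (ψ (i / L)).getD (i % L) a, fun q hq => List.ext_getElem? fun j => ?_⟩
  rcases Nat.lt_or_ge j L with hj | hj
  · have hdiv : (q * L + j) / L = q := by
      rw [Nat.add_comm, Nat.add_mul_div_right _ _ (by lia), Nat.div_eq_of_lt hj, Nat.zero_add]
    have hmod : (q * L + j) % L = j := by
      rw [Nat.add_comm, Nat.add_mul_mod_self_right, Nat.mod_eq_of_lt hj]
    rw [getElem?_factor _ _ hj, hdiv, hmod, List.getD_eq_getElem?_getD,
      List.getElem?_eq_getElem (by rwa [h q hq]), Option.getD_some]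
  · rw [List.getElem?_eq_none (by rwa [h q hq]), List.getElem?_eq_none (by simpa using hj)]

theorem eq_add_card_of_forall_ne {n : ℕ} {f : ℕ → Fin n}
    (h : ∀ i p, 0 < p → p < n → f i ≠ f (i + p)) (i : ℕ) : f i = f (i + n) := by
  have hinj : Function.Injective fun j : Fin n => f (i + j) :=
    .of_eq_imp_le fun {j k} hjk => by
      by_contra! hlt
      refine h (i + k) (j - k) (by lia) (by lia) ?_
      rw [show i + (k : ℕ) + (j - k) = i + j by lia]
      exact hjk.symm
  obtain ⟨j, hj⟩ := Finite.injective_iff_surjective.1 hinj (f (i + n))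
  rcases Nat.eq_zero_or_pos j with hj₀ | hj₀
  · simpa only [hj₀, Nat.add_zero] using hj
  · have hne := h (i + j) (n - j) (by lia) (by lia)
    rw [show i + (j : ℕ) + (n - j) = i + n by lia] at hne
    exact absurd hj hne

section Compactness

variable {n : ℕ} {ε : ℚ} {E : Set ℕ}

theorem isOpen_setOf_repeatsAt {α : Type*} [TopologicalSpace α] [DiscreteTopology α] (i p r : ℕ) :
    IsOpen {f : ℕ → α | RepeatsAt f i p r} := by
  have hinter : {f : ℕ → α | RepeatsAt f i p r} =
      ⋂ t ∈ Set.Iio r, {f : ℕ → α | f (i + t) = f (i + t + p)} := by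
    ext f
    simp [RepeatsAt]
  rw [hinter]
  refine (Set.finite_Iio r).isOpen_biInter fun t _ => ?_
  have hcont : Continuous fun f : ℕ → α => (f (i + t), f (i + t + p)) := by fun_prop
  exact (isOpen_discrete {x : α × α | x.1 = x.2}).preimage hcont

theorem isClosed_setOf_repBoundUpTo (ε : ℚ) (E : Set ℕ) (N : ℕ) :
    IsClosed {f : ℕ → Fin n | RepBoundUpTo ε E f N} := by
  simp only [RepBoundUpTo, Set.ofPred_forall]
  exact isClosed_iInter fun i => isClosed_iInter fun p => isClosed_iInter fun r =>
    isClosed_iInter fun _ => isClosed_iInter fun _ => isClosed_iInter fun _ =>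
      isClosed_imp (isOpen_setOf_repeatsAt i p r) isClosed_const

theorem exists_forall_repBoundUpTo (h : ∀ N, ∃ f : ℕ → Fin n, RepBoundUpTo ε E f N) :
    ∃ f : ℕ → Fin n, ∀ N, RepBoundUpTo ε E f N := by
  obtain ⟨f, hf⟩ := IsCompact.nonempty_iInter_of_sequence_nonempty_isCompact_isClosed
    (fun N => {f : ℕ → Fin n | RepBoundUpTo ε E f N}) (fun N f hf => hf.mono N.le_succ) h
    (isClosed_setOf_repBoundUpTo ε E 0).isCompact (isClosed_setOf_repBoundUpTo ε E)
  exact ⟨f, Set.mem_iInter.1 hf⟩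

end Compactness

section Critical

variable {n : ℕ} {ε : ℚ} {E : Set ℕ} {g : ℕ → Fin n} {N j r p p' : ℕ}

/-- A repetition with root of length `p` and repeated part of length `r` ends at position `j` of
`g`, and condition (M2) requires a substitution to give different images to its repeated parts. -/
structure IsCritical (ε : ℚ) (E : Set ℕ) (g : ℕ → Fin n) (j r p : ℕ) : Prop where
  root_pos : 0 < p
  pos : 0 < r
  mem : r ∈ E
  le : p + r ≤ j + 1
  repeatsAt : RepeatsAt g (j + 1 - p - r) p r
  not_le : ¬ ((n : ℚ) - 1) * (r + ε) ≤ p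

-- If both `p < p'` are critical, the two earlier occurrences of the repeated part are at distance
-- `p' - p`, so `p'` is the sum of two roots of length at least `(n - 1) * r`.
theorem IsCritical.not_root_lt (hn : 1 < n) (hε : 0 ≤ ε) (hε₁ : ε ≤ 1)
    (hg : RepBoundUpTo ε E g N) (hj : j < N) (h : IsCritical ε E g j r p)
    (h' : IsCritical ε E g j r p') : ¬ p < p' := fun hlt => by
  have hr := h.pos
  have hle' := h'.le
  have hrep : RepeatsAt g (j + 1 - p' - r) (p' - p) r := fun t ht => by
    have heq := h.repeatsAt t ht
    have heq' := h'.repeatsAt t ht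
    rw [show j + 1 - p - r + t + p = j + 1 - p' - r + t + p' by lia] at heq
    rw [show j + 1 - p' - r + t + (p' - p) = j + 1 - p - r + t by lia, heq, heq']
  have hp := (hg _ p r h.root_pos hr (by lia) h.repeatsAt).pred_mul_cast_le hn hε
  have hpp' := (hg _ (p' - p) r (by lia) hr (by lia) hrep).pred_mul_cast_le hn hε
  rw [Nat.cast_sub hlt.le] at hpp'
  have hn' : (0 : ℚ) ≤ n - 1 := sub_nonneg.2 (by exact_mod_cast hn.le)
  have hr' : ε ≤ r := hε₁.trans (by exact_mod_cast hr)
  have := mul_le_mul_of_nonneg_left hr' hn'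
  exact h'.not_le (by linarith)

theorem IsCritical.root_unique (hn : 1 < n) (hε : 0 ≤ ε) (hε₁ : ε ≤ 1)
    (hg : RepBoundUpTo ε E g N) (hj : j < N) (h : IsCritical ε E g j r p)
    (h' : IsCritical ε E g j r p') : p = p' :=
  le_antisymm (Nat.le_of_not_lt (h'.not_root_lt hn hε hε₁ hg hj h))
    (Nat.le_of_not_lt (h.not_root_lt hn hε hε₁ hg hj h'))

theorem IsCritical.letter_eq (h : IsCritical ε E g j 1 p) : g (j - p) = g j := by
  have := h.le
  have heq := h.repeatsAt 0 one_pos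
  rwa [show j + 1 - p - 1 + 0 = j - p by lia, Nat.sub_add_cancel (by lia)] at heq

theorem IsCritical.root_eq_pred (hn : 1 < n) (hε : 0 ≤ ε) (hε' : ε ≤ 1 / ((n : ℚ) - 1))
    (hg : RepBoundUpTo ε E g N) (hj : j < N) (h : IsCritical ε E g j 1 p) : p = n - 1 := by
  have hle := h.le
  have hn' : (0 : ℚ) < n - 1 := sub_pos.2 (by exact_mod_cast hn)
  have hp := (hg _ p 1 h.root_pos one_pos (by lia) h.repeatsAt).pred_mul_le hn hε
  have hpn : (p : ℚ) < n := by
    have hlt := lt_of_not_ge h.not_le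
    rw [le_div_iff₀ hn'] at hε'
    push_cast at hlt
    linarith
  have : p < n := by exact_mod_cast hpn
  lia

-- Otherwise a factor of length 2 would be repeated after `n - 1` letters.
theorem IsCritical.not_isCritical_succ (hn : 1 < n) (hε : 0 ≤ ε) (hε' : ε ≤ 1 / ((n : ℚ) - 1))
    (hg : RepBoundUpTo ε E g (j + 2)) (h : IsCritical ε E g j 1 p) :
    ¬ IsCritical ε E g (j + 1) 1 p' := fun h' => by
  obtain rfl := h.root_eq_pred hn hε hε' hg (by lia)
  obtain rfl := h'.root_eq_pred hn hε hε' hg (by lia)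
  have hle := h.le
  have hrep : RepeatsAt g (j - (n - 1)) (n - 1) 2 := by
    rintro (_ | _ | t) ht
    · rw [Nat.add_zero, Nat.sub_add_cancel (by lia)]
      exact h.letter_eq
    · have heq := h'.letter_eq
      rwa [show j + 1 - (n - 1) = j - (n - 1) + (0 + 1) by lia,
        show j + 1 = j - (n - 1) + (0 + 1) + (n - 1) by lia] at heq
    · lia
  have := (hg _ _ 2 (by lia) two_pos (by lia) hrep).pred_mul_le hn hε
  lia

end Critical

namespace ImageSystem

variable {n L : ℕ} {S : ImageSystem n L} {ε : ℚ} {E : Set ℕ} {g : ℕ → Fin n}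
  {ψ : ℕ → List (Fin n)} {N j : ℕ} {v : List (Fin n)}

variable (S) in
/-- The images of the `j`-th letter of `g` that may follow the image `ψ (j - 1)` of the preceding
letter, if there is one. -/
def followingImages (g : ℕ → Fin n) (ψ : ℕ → List (Fin n)) : ℕ → Finset (List (Fin n))
  | 0 => S.V (g 0)
  | j + 1 => S.δ (g (j + 1)) (ψ j)

open Classical in
variable (S ε E) in
/-- The images that may be chosen for the `j`-th letter of `g` after the images `ψ 0`, …,
`ψ (j - 1)` of the preceding letters. To satisfy condition (M2) for a repetition ending at `j` it
suffices that the last letters of the repeated parts get different images. -/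
noncomputable def allowedImages (g : ℕ → Fin n) (ψ : ℕ → List (Fin n)) (j : ℕ) :
    Finset (List (Fin n)) :=
  {v ∈ S.followingImages g ψ j | ∀ r p, IsCritical ε E g j r p → v ≠ ψ (j - p)}

theorem card_followingImages_le (hn : 1 < n) (hε : 0 ≤ ε) (hε₁ : ε ≤ 1)
    (hg : RepBoundUpTo ε E g N) (hj : j < N) (ψ : ℕ → List (Fin n)) {R : Finset ℕ}
    (hR : ∀ r p, IsCritical ε E g j r p → r ∈ R) :
    (S.followingImages g ψ j).card ≤ (S.allowedImages ε E g ψ j).card + R.card := by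
  classical
  have hroot : ∀ r, ∃ p, ∀ p', IsCritical ε E g j r p' → p' = p := fun r => by
    by_cases hr : ∃ p, IsCritical ε E g j r p
    · obtain ⟨p, hp⟩ := hr
      exact ⟨p, fun p' hp' => hp'.root_unique hn hε hε₁ hg hj hp⟩
    · exact ⟨0, fun p' hp' => absurd ⟨p', hp'⟩ hr⟩
  choose P hP using hroot
  have hsub : S.followingImages g ψ j ⊆
      S.allowedImages ε E g ψ j ∪ R.image fun r => ψ (j - P r) := fun v hv => by
    by_cases hv' : v ∈ S.allowedImages ε E g ψ j
    · exact Finset.mem_union_left _ hv'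
    · simp only [allowedImages, Finset.mem_filter, hv, true_and, not_forall, not_not] at hv'
      obtain ⟨r, p, hc, rfl⟩ := hv'
      exact Finset.mem_union_right _ (Finset.mem_image.2 ⟨r, hR r p hc, by rw [hP r p hc]⟩)
  exact (Finset.card_le_card hsub).trans <|
    (Finset.card_union_le _ _).trans (Nat.add_le_add_left Finset.card_image_le _)

theorem deltaMin_le_card {a b : Fin n} (hab : a ≠ b) (hv : v ∈ S.V a) :
    S.deltaMin ≤ (S.δ b v).card :=
  Nat.sInf_le ⟨a, b, hab, v, hv, rfl⟩

theorem IsSubstitutionUpTo.update (hn : 2 < n) (hε : 0 ≤ ε) (hg : RepBoundUpTo ε E g (N + 1))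
    (hψ : S.IsSubstitutionUpTo ε E g ψ N) (hv : v ∈ S.allowedImages ε E g ψ N) :
    S.IsSubstitutionUpTo ε E g (Function.update ψ N v) (N + 1) := by
  classical
  obtain ⟨hv_follows, hv_ne⟩ := Finset.mem_filter.1 hv
  have hold : ∀ q, q < N → Function.update ψ N v q = ψ q := fun q hq =>
    Function.update_of_ne hq.ne _ _
  have hnew : Function.update ψ N v N = v := Function.update_self _ _ _
  refine ⟨fun q hq => ?_, fun q hq => ?_, fun i p r hp hr hi hrep hrE hlt => ?_⟩
  · rcases Nat.lt_succ_iff_lt_or_eq.1 hq with hq | rfl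
    · rw [hold q hq]
      exact hψ.mem q hq
    · rw [hnew]
      rcases q with _ | j
      · exact hv_follows
      · exact S.δ_subset _ _ (hg.ne_succ hn hε (by lia)) _ (hψ.mem j (by lia)) hv_follows
  · rw [hold q (by lia)]
    rcases Nat.lt_succ_iff_lt_or_eq.1 hq with hq | rfl
    · rw [hold _ hq]
      exact hψ.follows q hq
    · rw [hnew]
      exact hv_follows
  · rcases Nat.lt_succ_iff_lt_or_eq.1 (Nat.lt_succ_of_le hi) with hi | hi
    · obtain ⟨m, hm, hne⟩ := hψ.splits i p r hp hr (by lia) hrep hrE hlt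
      exact ⟨m, hm, by rwa [hold _ (by lia), hold _ (by lia)]⟩
    · have hcrit : IsCritical ε E g N r p :=
        ⟨hp, hr, hrE, by lia, by rwa [show N + 1 - p - r = i by lia], hlt⟩
      refine ⟨r - 1, by lia, ?_⟩
      rw [show i + (r - 1) + p = N by lia, hnew, hold _ (by lia),
        show i + (r - 1) = N - p by lia]
      exact (hv_ne r p hcrit).symm

open Classical in
variable (S ε E) in
/-- Substitutions on the first `N` letters of `g`, built from left to right. The value of each of
them at every further position is the empty word, so that different elements of the set differ on
these `N` letters. -/
noncomputable def substitutions (g : ℕ → Fin n) : ℕ → Finset (ℕ → List (Fin n))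
  | 0 => {fun _ => []}
  | N + 1 => (substitutions g N).biUnion fun ψ =>
      (S.allowedImages ε E g ψ N).image (Function.update ψ N)

theorem eq_nil_of_mem_substitutions (hψ : ψ ∈ S.substitutions ε E g N) {q : ℕ} (hq : N ≤ q) :
    ψ q = [] := by
  induction N generalizing ψ with
  | zero => rw [Finset.mem_singleton.1 hψ]
  | succ N ih =>
    simp only [substitutions, Finset.mem_biUnion, Finset.mem_image] at hψ
    obtain ⟨ψ, hψ, v, -, rfl⟩ := hψ
    rw [Function.update_of_ne (by lia), ih hψ (by lia)]

theorem isSubstitutionUpTo_of_mem_substitutions (hn : 2 < n) (hε : 0 ≤ ε)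
    (hg : RepBoundUpTo ε E g N) (hψ : ψ ∈ S.substitutions ε E g N) :
    S.IsSubstitutionUpTo ε E g ψ N := by
  induction N generalizing ψ with
  | zero => exact ⟨fun q hq => by lia, fun q hq => by lia, fun i p r _ hr hi => by lia⟩
  | succ N ih =>
    simp only [substitutions, Finset.mem_biUnion, Finset.mem_image] at hψ
    obtain ⟨ψ, hψ, v, hv, rfl⟩ := hψ
    exact (ih (hg.mono N.le_succ) hψ).update hn hε hg hv

theorem mul_card_substitutions_le {c : ℕ}
    (hc : ∀ ψ ∈ S.substitutions ε E g N, c ≤ (S.allowedImages ε E g ψ N).card) :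
    c * (S.substitutions ε E g N).card ≤ (S.substitutions ε E g (N + 1)).card := by
  classical
  have hdisj : (S.substitutions ε E g N : Set (ℕ → List (Fin n))).PairwiseDisjoint fun ψ =>
      (S.allowedImages ε E g ψ N).image (Function.update ψ N) := by
    intro ψ hψ ψ' hψ' hne
    rw [Function.onFun, Finset.disjoint_left]
    intro _ hχ hχ'
    obtain ⟨v, -, rfl⟩ := Finset.mem_image.1 hχ
    obtain ⟨v', -, he⟩ := Finset.mem_image.1 hχ'
    refine hne (funext fun q => ?_)
    rcases eq_or_ne q N with rfl | hq
    · rw [eq_nil_of_mem_substitutions hψ le_rfl, eq_nil_of_mem_substitutions hψ' le_rfl]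
    · simpa only [Function.update_of_ne hq] using (congrFun he q).symm
  rw [substitutions, Finset.card_biUnion hdisj, Nat.mul_comm, ← smul_eq_mul]
  refine Finset.card_nsmul_le_sum _ _ _ fun ψ hψ => ?_
  rw [Finset.card_image_of_injective _ (Function.update_injective ψ N)]
  exact hc ψ hψ

namespace Admissible

variable (A : S.Admissible ε E)
include A

theorem two_lt_card : 2 < n := by
  have := A.five_le
  lia

theorem isSubstitutionUpTo (hg : RepBoundUpTo ε E g N) (hψ : ψ ∈ S.substitutions ε E g N) :
    S.IsSubstitutionUpTo ε E g ψ N :=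
  isSubstitutionUpTo_of_mem_substitutions A.two_lt_card A.eps_nonneg hg hψ

theorem deltaMin_le_card_allowedImages_add_card (hg : RepBoundUpTo ε E g (j + 2))
    (hψ : ψ j ∈ S.V (g j)) {R : Finset ℕ} (hR : ∀ r p, IsCritical ε E g (j + 1) r p → r ∈ R) :
    S.deltaMin ≤ (S.allowedImages ε E g ψ (j + 1)).card + R.card :=
  (deltaMin_le_card (hg.ne_succ A.two_lt_card A.eps_nonneg (by lia)) hψ).trans
    (card_followingImages_le A.one_lt_card A.eps_nonneg A.eps_le_one hg (by lia) ψ hR)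

theorem exists_isImage (hg : RepBoundUpTo ε E g N) (hψ : S.IsSubstitutionUpTo ε E g ψ N) :
    ∃ f, S.IsImage ε E g ψ f N := by
  have : Nonempty (Fin n) := ⟨⟨0, by have := A.one_lt_card; lia⟩⟩
  obtain ⟨f, hf⟩ := exists_eq_factor_of_length_eq
    fun q hq => S.V_length _ _ (hψ.mem q hq)
  exact ⟨f, A, hg, hψ, hf⟩

theorem card_substitutions_le_thresholdCount (hg : RepBoundUpTo ε E g N) :
    (S.substitutions ε E g N).card ≤ thresholdCount n (N * L) := by
  have hfin : {w : List (Fin n) | w.length = N * L ∧ IsThreshold w}.Finite :=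
    (List.finite_length_eq (Fin n) (N * L)).subset fun w hw => hw.1
  rw [thresholdCount, ← Set.ncard_coe_finset]
  refine Set.ncard_le_ncard_of_injOn (fun ψ => (factor ψ 0 N).flatten) ?_ ?_ hfin
  · intro ψ hψ
    obtain ⟨f, H⟩ := A.exists_isImage hg (A.isSubstitutionUpTo hg hψ)
    have hflat := flatten_factor (i := 0) (k := N) fun q _ hq => H.eq_factor q (by lia)
    simp only [hflat]
    exact ⟨length_factor _ _ _,
      H.repBoundUpTo_image.isThreshold A.one_lt_card A.eps_nonneg (by lia)⟩
  · have hlen : ∀ ψ ∈ S.substitutions ε E g N,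
        (factor ψ 0 N).map List.length = List.replicate N L := fun ψ hψ => by
      refine List.eq_replicate_iff.2 ⟨by simp, fun k hk => ?_⟩
      simp only [factor, List.map_map, List.mem_map, List.mem_range, Function.comp_apply,
        Nat.zero_add] at hk
      obtain ⟨q, hq, rfl⟩ := hk
      exact S.V_length _ _ ((A.isSubstitutionUpTo hg hψ).mem q hq)
    intro ψ hψ ψ' hψ' he
    have hfac := List.eq_iff_flatten_eq.2 ⟨he, (hlen ψ hψ).trans (hlen ψ' hψ').symm⟩
    funext q
    rcases Nat.lt_or_ge q N with hq | hq
    · simpa only [Nat.zero_add] using factor_eq_factor_iff.1 hfac q hq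
    · rw [eq_nil_of_mem_substitutions hψ hq, eq_nil_of_mem_substitutions hψ' hq]

variable (hδ : E.encard < (S.deltaMin : ℕ∞))
include hδ

theorem allowedImages_nonempty (hg : RepBoundUpTo ε E g (N + 1))
    (hψ : S.IsSubstitutionUpTo ε E g ψ N) : (S.allowedImages ε E g ψ N).Nonempty := by
  have hfin : E.Finite := Set.finite_of_encard_le_coe hδ.le
  rw [← Finset.card_pos]
  rcases N with _ | j
  · have hle := card_followingImages_le (S := S) A.one_lt_card A.eps_nonneg A.eps_le_one hg
      one_pos ψ (R := ∅) fun r p hc => by have := hc.le; have := hc.pos; have := hc.root_pos; lia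
    exact (S.V_nonempty (g 0)).card_pos.trans_le hle
  · have hle := A.deltaMin_le_card_allowedImages_add_card hg (hψ.mem j (by lia))
      (R := hfin.toFinset) fun r p hc => hfin.mem_toFinset.2 hc.mem
    rw [hfin.encard_eq_coe_toFinset_card] at hδ
    have : hfin.toFinset.card < S.deltaMin := by exact_mod_cast hδ
    lia

theorem two_le_card_allowedImages (h₁ : 1 ∈ E) (hg : RepBoundUpTo ε E g (j + 2))
    (hψ : ψ j ∈ S.V (g j)) (hcrit : ∀ p, ¬ IsCritical ε E g (j + 1) 1 p) :
    2 ≤ (S.allowedImages ε E g ψ (j + 1)).card := by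
  have hfin : E.Finite := Set.finite_of_encard_le_coe hδ.le
  have hle := A.deltaMin_le_card_allowedImages_add_card hg hψ (R := hfin.toFinset.erase 1)
    fun r p hc => Finset.mem_erase.2
      ⟨by rintro rfl; exact hcrit p hc, hfin.mem_toFinset.2 hc.mem⟩
  rw [hfin.encard_eq_coe_toFinset_card] at hδ
  have hlt : hfin.toFinset.card < S.deltaMin := by exact_mod_cast hδ
  have := Finset.card_erase_add_one (hfin.mem_toFinset.2 h₁)
  lia

theorem card_substitutions_le_succ (hg : RepBoundUpTo ε E g (N + 1)) :
    (S.substitutions ε E g N).card ≤ (S.substitutions ε E g (N + 1)).card := by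
  have hle := mul_card_substitutions_le (c := 1) fun ψ hψ => Finset.card_pos.2 <|
    A.allowedImages_nonempty hδ hg (A.isSubstitutionUpTo (hg.mono N.le_succ) hψ)
  rwa [one_mul] at hle

theorem substitutions_nonempty (hg : RepBoundUpTo ε E g N) :
    (S.substitutions ε E g N).Nonempty := by
  rw [← Finset.card_pos]
  induction N with
  | zero => simp [substitutions]
  | succ N ih =>
    exact (ih (hg.mono N.le_succ)).trans_le (A.card_substitutions_le_succ hδ hg)

theorem exists_repBoundUpTo (N : ℕ) : ∃ g : ℕ → Fin n, RepBoundUpTo ε E g N := by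
  have hL := A.one_lt
  induction N with
  | zero => exact ⟨fun _ => ⟨0, by have := A.one_lt_card; lia⟩, fun i p r hp hr hi => by lia⟩
  | succ N ih =>
    obtain ⟨g, hg⟩ := ih
    rcases Nat.eq_zero_or_pos N with rfl | hN
    · exact ⟨g, fun i p r hp hr hi => by lia⟩
    obtain ⟨ψ, hψ⟩ := A.substitutions_nonempty hδ hg
    obtain ⟨f, H⟩ := A.exists_isImage hg (A.isSubstitutionUpTo hg hψ)
    have := Nat.mul_le_mul_left N hL
    exact ⟨f, H.repBoundUpTo_image.mono (by lia)⟩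

-- If `1 ∉ E`, every `n` consecutive letters of an `(ε, E)`-threshold word are different because
-- `0 < ε`, so an infinite one is periodic with period `n`.
theorem one_mem : 1 ∈ E := by
  by_contra h₁
  have hn := A.one_lt_card
  obtain ⟨g, hg⟩ := exists_forall_repBoundUpTo (A.exists_repBoundUpTo hδ)
  have hne : ∀ i p, 0 < p → p < n → g i ≠ g (i + p) := fun i p hp hpn he => by
    have hb := hg (i + p + 1) i p 1 hp one_pos le_rfl fun t ht => by
      obtain rfl : t = 0 := by lia
      exact he
    have hn' : (0 : ℚ) < n - 1 := sub_pos.2 (by exact_mod_cast hn)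
    have hp' : (p : ℚ) + 1 ≤ n := by exact_mod_cast hpn
    have := mul_pos hn' A.eps_pos
    rw [RepBound, chi_of_notMem h₁] at hb
    push_cast at hb
    linarith
  have hper := (hg (n + 2) 0 n 2 (by lia) two_pos (by lia) fun t _ =>
    eq_add_card_of_forall_ne hne _).pred_mul_le hn A.eps_nonneg
  have := A.five_le
  lia

theorem two_mul_card_substitutions_le_of_not_isCritical (hg : RepBoundUpTo ε E g (j + 2))
    (hcrit : ∀ p, ¬ IsCritical ε E g (j + 1) 1 p) :
    2 * (S.substitutions ε E g (j + 1)).card ≤ (S.substitutions ε E g (j + 2)).card :=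
  mul_card_substitutions_le fun _ hψ => A.two_le_card_allowedImages hδ (A.one_mem hδ) hg
    ((A.isSubstitutionUpTo (hg.mono (by lia)) hψ).mem j (by lia)) hcrit

theorem two_mul_card_substitutions_le (hε : ε ≤ 1 / ((n : ℚ) - 1))
    (hg : RepBoundUpTo ε E g (j + 3)) :
    2 * (S.substitutions ε E g (j + 1)).card ≤ (S.substitutions ε E g (j + 3)).card := by
  have hg' : RepBoundUpTo ε E g (j + 2) := hg.mono (by lia)
  by_cases h : ∃ p, IsCritical ε E g (j + 1) 1 p
  · obtain ⟨p, hp⟩ := h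
    exact (Nat.mul_le_mul_left 2 (A.card_substitutions_le_succ hδ hg')).trans <|
      A.two_mul_card_substitutions_le_of_not_isCritical hδ hg fun _ =>
        hp.not_isCritical_succ A.one_lt_card A.eps_nonneg hε hg
  · exact (A.two_mul_card_substitutions_le_of_not_isCritical hδ hg' (not_exists.1 h)).trans
      (A.card_substitutions_le_succ hδ hg)

theorem two_pow_le_card_substitutions (hε : ε ≤ 1 / ((n : ℚ) - 1)) {k : ℕ}
    (hg : RepBoundUpTo ε E g (2 * k + 1)) :
    2 ^ k ≤ (S.substitutions ε E g (2 * k + 1)).card := by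
  induction k with
  | zero => exact (A.substitutions_nonempty hδ hg).card_pos
  | succ k ih =>
    rw [pow_succ']
    exact (Nat.mul_le_mul_left 2 (ih (hg.mono (by lia)))).trans
      (A.two_mul_card_substitutions_le hδ hε (j := 2 * k) hg)

theorem two_pow_le_thresholdCount (hε : ε ≤ 1 / ((n : ℚ) - 1)) (k : ℕ) :
    2 ^ k ≤ thresholdCount n ((2 * k + 1) * L) := by
  obtain ⟨g, hg⟩ := A.exists_repBoundUpTo hδ (2 * k + 1)
  exact (A.two_pow_le_card_substitutions hδ hε hg).trans (A.card_substitutions_le_thresholdCount hg)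

end Admissible

end ImageSystem

theorem thresholdCount_add_le (n a b : ℕ) :
    thresholdCount n (a + b) ≤ thresholdCount n a * n ^ b := by
  have hcard : {w : List (Fin n) | w.length = b}.ncard = n ^ b := by
    rw [← Nat.card_coe_set_eq]
    change Nat.card (List.Vector (Fin n) b) = n ^ b
    rw [Nat.card_eq_fintype_card, card_vector, Fintype.card_fin]
  have hfin : {w : List (Fin n) | w.length = a ∧ IsThreshold w}.Finite :=
    (List.finite_length_eq (Fin n) a).subset fun w hw => hw.1
  rw [thresholdCount, thresholdCount, ← hcard, ← Set.ncard_prod]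
  refine Set.ncard_le_ncard_of_injOn (fun w => (w.take a, w.drop a)) ?_ ?_
    (hfin.prod (List.finite_length_eq (Fin n) b))
  · rintro w ⟨hw, hT⟩
    exact ⟨⟨by simp [hw], fun v hv hvw => hT v hv (hvw.trans (List.take_prefix a w).isInfix)⟩,
      by simp [hw]⟩
  · intro w _ w' _ he
    obtain ⟨htake, hdrop⟩ := Prod.mk.inj he
    rw [← List.take_append_drop a w, ← List.take_append_drop a w', htake, hdrop]

theorem exists_mul_pow_le_of_two_pow_le {c : ℕ → ℕ} {d L : ℕ} (hd : 0 < d) (hL : 0 < L)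
    (hadd : ∀ a b, c (a + b) ≤ c a * d ^ b) (hpow : ∀ k, 2 ^ k ≤ c ((2 * k + 1) * L)) :
    ∃ C γ : ℝ, 0 < C ∧ 1 < γ ∧ ∀ m : ℕ, C * γ ^ m ≤ c m := by
  have hd₁ : (1 : ℝ) ≤ d := by exact_mod_cast hd
  have hL₀ : (0 : ℝ) < 2 * L := by positivity
  refine ⟨1 / (d : ℝ) ^ (3 * L), 2 ^ (1 / (2 * L : ℝ)), by positivity,
    Real.one_lt_rpow one_lt_two (by positivity), fun m => ?_⟩
  let k := m / (2 * L) + 1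
  have hm : m / (2 * L) * (2 * L) + m % (2 * L) = m := Nat.div_add_mod' m (2 * L)
  have hm_lt : m % (2 * L) < 2 * L := Nat.mod_lt m (by lia)
  obtain ⟨b, hb⟩ : ∃ b, (2 * k + 1) * L = m + b :=
    ⟨(2 * k + 1) * L - m, by rw [show (2 * k + 1) * L = k * (2 * L) + L by ring]; lia⟩
  have hbL : b ≤ 3 * L := by
    rw [show (2 * k + 1) * L = k * (2 * L) + L by ring] at hb
    lia
  have hroot : ((2 : ℝ) ^ (1 / (2 * L : ℝ))) ^ m ≤ 2 ^ k := by
    rw [← Real.rpow_natCast, ← Real.rpow_mul zero_le_two, ← Real.rpow_natCast 2 k]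
    refine Real.rpow_le_rpow_of_exponent_le one_le_two ?_
    rw [one_div_mul_eq_div, div_le_iff₀ hL₀]
    exact_mod_cast (by lia : m ≤ k * (2 * L))
  rw [one_div_mul_eq_div, div_le_iff₀ (by positivity)]
  calc ((2 : ℝ) ^ (1 / (2 * L : ℝ))) ^ m ≤ 2 ^ k := hroot
    _ ≤ c m * (d : ℝ) ^ b := by exact_mod_cast (hb ▸ hpow k).trans (hadd m b)
    _ ≤ c m * (d : ℝ) ^ (3 * L) := by gcongr

end ThresholdWords

theorem mainTheorem3 (n L : ℕ) (hn : 5 ≤ n) (hL : 1 < L) (ε : ℚ) (hε : 0 ≤ ε) (E : Set ℕ)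
    (S : ThresholdWords.ImageSystem n L) (hS : S.Consistent ε E)
    (hlc : ε * ((L : ℚ) - 1) = (S.lcsV : ℚ) + (S.lcpV : ℚ))
    (hδ : E.encard < (S.deltaMin : ℕ∞)) :
    (∃ f : ℕ → Fin n, ThresholdWords.IsInfiniteThreshold f) ∧
    (ε ≤ 1 / ((n : ℚ) - 1) →
      ∃ C γ : ℝ, 0 < C ∧ 1 < γ ∧
        ∀ m : ℕ, C * γ ^ m ≤ (ThresholdWords.thresholdCount n m : ℝ)) := by
  have A : S.Admissible ε E := ⟨hn, hL, hS, hlc⟩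
  constructor
  · obtain ⟨f, hf⟩ := ThresholdWords.exists_forall_repBoundUpTo (A.exists_repBoundUpTo hδ)
    exact ⟨f, fun i k => (hf (i + k)).isThreshold A.one_lt_card hε le_rfl⟩
  · exact fun hε' => ThresholdWords.exists_mul_pow_le_of_two_pow_le (by lia) (by lia)
      (ThresholdWords.thresholdCount_add_le n) (A.two_pow_le_thresholdCount hδ hε')
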